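/- Let $\mathbb X=[0,1)$ with its Borel $\sigma$-algebra and Lebesgue measure $\lambda$, and let $\Phi$ be the standard normal distribution function. For $\theta\in[0,1]$ put $$f_\theta(x)=\exp\{-\theta+\sqrt{2\theta}\,\Phi^{-1}(x)\},$$ so that $f_0$ is the uniform density (the value at the null point $x=0$ is immaterial; there we set $\Phi^{-1}(0):=0$), and let $\mathbb F_0=\{f_\theta:\theta\in[0,1]\}$. For $N\ge 1$ let $\mathbb F_N$ be the set of the $\binom{2N^2}{N^2}$ densities which equal $2$ on exactly $N^2$ of the intervals $[\frac{j}{2N^2},\frac{j+1}{2N^2})$, $j=0,\dots,2N^2-1$, and equal $0$ on the remaining ones. Let $\mathbb F_\triangle=\bigcup_{N\ge1}\mathbb F_N$ and $\mathbb F=\mathbb F_0\cup\mathbb F_\triangle$, equipped with the Borel $\sigma$-algebra of the topology of weak convergence of the associated probability measures. Let the prior on $\mathbb F$ be $\Pi=\frac12\Pi_0+\frac12\Pi_\triangle$, where $\Pi_0$ is the law of $f_\theta$ when $\theta$ is drawn from the probability measure on $[0,1]$ proportional to $e^{-1/\theta}\,d\theta$, and $\Pi_\triangle$ is the probability measure proportional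 to $$\sum_{N\ge1}\frac1{N^2}\sum_{g\in\mathbb F_N}\binom{2N^2}{N^2}^{-1}\delta_g .$$ For $f_\star\in\mathbb F$ let $F_\star$ be the probability measure with density $f_\star$, let $X_1,X_2,\dots$ be i.i.d. from $F_\star$, and let $$\Pi(df\mid X_{1:n})=\frac{R_n(f)\,\Pi(df)}{\int_{\mathbb F}R_n(g)\,\Pi(dg)},\qquad R_n(f)=\prod_{i=1}^n\frac{f(X_i)}{f_\star(X_i)},$$ be the posterior distribution. Let $d_h(f,g)=\big(\int_{\mathbb X}(\sqrt f-\sqrt g)^2\,d\lambda\big)^{1/2}$ be the Hellinger distance. **Lemma.** The posterior is Hellinger consistent at every $f_\star\in\mathbb F\setminus\{f_0\}$: for every such $f_\star$ and every $\varepsilon>0$, $$\lim_{n\to\infty}\Pi\big(\{f\in\mathbb F: d_h(f,f_\star)>\varepsilon\}\mid X_{1:n}\big)=0\qquad F_\star^\infty\text{-almost surely}.$$ -/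

import Mathlib

open MeasureTheory ProbabilityTheory Filter Topology

open scoped ENNReal

noncomputable section

/-! # Densities, posterior distributions, Hellinger consistency -/

/-- A probability density on `X` with respect to the reference measure `lam`. -/
structure Density {X : Type*} [MeasurableSpace X] (lam : Measure X) where
  toFun : X → ℝ
  measurable_toFun : Measurable toFun
  nonneg : ∀ x, 0 ≤ toFun x
  lintegral_eq_one : ∫⁻ x, ENNReal.ofReal (toFun x) ∂lam = 1

namespace Density

section General

variable {X : Type*} [MeasurableSpace X] {lam : Measure X}

instance : CoeFun (Density lam) (fun _ => X → ℝ) := ⟨Density.toFun⟩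

/-- The probability measure with density `f`. -/
def law (f : Density lam) : ProbabilityMeasure X :=
  ⟨lam.withDensity fun x => ENNReal.ofReal (f x),
    ⟨by rw [withDensity_apply _ MeasurableSet.univ, Measure.restrict_univ]
        exact f.lintegral_eq_one⟩⟩

/-- The Hellinger distance, `d_h(f, g)² = ∫ (√f - √g)² dλ`. -/
def hellingerDist (f g : Density lam) : ℝ :=
  Real.sqrt (∫ x, (Real.sqrt (f x) - Real.sqrt (g x)) ^ 2 ∂lam)

/-- The likelihood ratio `R_n(f) = ∏_{i < n} f(x_i) / fstar(x_i)` of the first `n` observations. -/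
def likelihoodRatio (fstar f : Density lam) (n : ℕ) (x : ℕ → X) : ℝ :=
  ∏ i ∈ Finset.range n, f (x i) / fstar (x i)

variable [TopologicalSpace X] [OpensMeasurableSpace X]

/-- The topology of weak convergence of the associated probability measures. -/
instance : TopologicalSpace (Density lam) :=
  TopologicalSpace.induced Density.law inferInstance

instance : MeasurableSpace (Density lam) := borel (Density lam)

instance : BorelSpace (Density lam) := ⟨rfl⟩

/-- The posterior distribution `Π(df | x_1, …, x_n) = R_n(f) Π(df) / ∫ R_n(g) Π(dg)` of a prior `Π`
on a family `F` of densities. -/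
def posterior (F : Set (Density lam)) (prior : Measure F) (fstar : Density lam) (n : ℕ)
    (x : ℕ → X) : Measure F :=
  (∫⁻ g : F, ENNReal.ofReal (likelihoodRatio fstar g n x) ∂prior)⁻¹ •
    prior.withDensity fun f : F => ENNReal.ofReal (likelihoodRatio fstar f n x)

/-- The posterior is Hellinger consistent at `fstar`: for all `ε > 0`, the posterior probability of
`{f ∈ F : d_h(f, fstar) > ε}` tends to `0` for almost every sequence of i.i.d. observations from
`fstar`. -/
def HellingerConsistentAt (F : Set (Density lam)) (prior : Measure F) (fstar : Density lam) :
    Prop :=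
  ∀ ε : ℝ, 0 < ε →
    ∀ᵐ x ∂(Measure.infinitePi fun _ : ℕ => (fstar.law : Measure X)),
      Tendsto (fun n : ℕ =>
        posterior F prior fstar n x {f : F | ε < hellingerDist (f : Density lam) fstar})
        atTop (𝓝 0)

end General

end Density

/-- The rescaling of a measure to total mass one. -/
def normalizedMeasure {α : Type*} [MeasurableSpace α] (μ : Measure α) : Measure α :=
  (μ Set.univ)⁻¹ • μ

/-! # Barron's model -/

namespace Barron

/-- The sample space `[0, 1)`. -/
abbrev Sample : Type := Set.Ico (0 : ℝ) 1

/-- Lebesgue measure on `[0, 1)`. -/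
def leb : Measure Sample := (volume : Measure ℝ).comap Subtype.val

/-- The standard normal cumulative distribution function. -/
def normalCDF (z : ℝ) : ℝ := cdf (gaussianReal 0 1) z

/-- The standard normal quantile function: on `(0, 1)` it is the inverse of `normalCDF`. At the
Lebesgue-null point `p = 0`, where the inverse is `-∞`, its value is set to `0`. -/
def normalQuantile (p : ℝ) : ℝ := sInf {z : ℝ | p ≤ normalCDF z}

lemma normalQuantile_le_iff {p : ℝ} (h0 : 0 < p) (h1 : p < 1) (z : ℝ) :
    normalQuantile p ≤ z ↔ p ≤ normalCDF z := by
  have hbdd : BddBelow {z : ℝ | p ≤ normalCDF z} := by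
    have h := (tendsto_cdf_atBot (gaussianReal 0 1)).eventually (gt_mem_nhds h0)
    obtain ⟨b, hb⟩ := h.exists
    refine ⟨b, fun w hw => ?_⟩
    by_contra hlt
    have h2 := monotone_cdf (gaussianReal 0 1) (not_le.1 hlt).le
    exact absurd (lt_of_le_of_lt (le_trans hw h2) hb) (lt_irrefl _)
  have hne : {z : ℝ | p ≤ normalCDF z}.Nonempty := by
    have h := (tendsto_cdf_atTop (gaussianReal 0 1)).eventually (lt_mem_nhds h1)
    obtain ⟨b, hb⟩ := h.exists
    exact ⟨b, le_of_lt hb⟩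
  constructor
  · intro h
    have hright : Tendsto normalCDF (𝓝[>] z) (𝓝 (normalCDF z)) :=
      ((cdf (gaussianReal 0 1)).right_continuous z).mono_left
        (nhdsWithin_mono _ Set.Ioi_subset_Ici_self)
    refine ge_of_tendsto hright ?_
    filter_upwards [self_mem_nhdsWithin] with w hw
    obtain ⟨v, hv, hvw⟩ := exists_lt_of_csInf_lt hne (lt_of_le_of_lt h hw)
    exact le_trans hv (monotone_cdf (gaussianReal 0 1) hvw.le)
  · intro h
    exact csInf_le hbdd h

lemma measurable_normalQuantile_sample :
    Measurable fun x : Sample => normalQuantile x := by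
  refine measurable_of_Iic fun z => ?_
  have h : (fun x : Sample => normalQuantile x) ⁻¹' Set.Iic z =
      ({x : Sample | 0 < (x : ℝ)} ∩ {x : Sample | (x : ℝ) ≤ normalCDF z}) ∪
        ({x : Sample | (x : ℝ) ≤ 0} ∩ {_x : Sample | normalQuantile 0 ≤ z}) := by
    ext x
    rcases eq_or_lt_of_le x.2.1 with hx | hx
    · simp [← hx]
    · simp [hx, not_le.2 hx, normalQuantile_le_iff hx x.2.2]
  rw [h]
  refine MeasurableSet.union (MeasurableSet.inter ?_ ?_) (MeasurableSet.inter ?_ ?_)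
  · exact measurableSet_lt measurable_const measurable_subtype_coe
  · exact measurableSet_le measurable_subtype_coe measurable_const
  · exact measurableSet_le measurable_subtype_coe measurable_const
  · exact MeasurableSet.const _

instance : IsProbabilityMeasure leb := by
  refine ⟨?_⟩
  rw [leb, comap_subtype_coe_apply measurableSet_Ico, Set.image_univ, Subtype.range_coe,
    Real.volume_Ico]
  simp

/-- Under Lebesgue measure on `[0, 1)`, the normal quantile function is standard normal. -/
lemma map_normalQuantile :
    leb.map (fun x : Sample => normalQuantile x) = gaussianReal 0 1 := by
  have hm := measurable_normalQuantile_sample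
  have : IsProbabilityMeasure (leb.map (fun x : Sample => normalQuantile x)) :=
    Measure.isProbabilityMeasure_map hm.aemeasurable
  refine Measure.ext_of_Iic _ _ fun z => ?_
  rw [Measure.map_apply hm measurableSet_Iic, ← ofReal_cdf, leb,
    comap_subtype_coe_apply measurableSet_Ico]
  change _ = ENNReal.ofReal (normalCDF z)
  have h0 : 0 ≤ normalCDF z := cdf_nonneg _ z
  have h1 : normalCDF z ≤ 1 := cdf_le_one _ z
  refine le_antisymm ?_ ?_
  · calc volume _ ≤ volume (Set.Icc 0 (normalCDF z)) := by
          refine measure_mono ?_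
          rintro _ ⟨x, hx, rfl⟩
          refine ⟨x.2.1, ?_⟩
          rcases eq_or_lt_of_le x.2.1 with h | h
          · rw [← h]; exact h0
          · exact (normalQuantile_le_iff h x.2.2 z).1 hx
      _ = ENNReal.ofReal (normalCDF z) := by rw [Real.volume_Icc, sub_zero]
  · calc ENNReal.ofReal (normalCDF z) = volume (Set.Ioo 0 (normalCDF z)) := by
          rw [Real.volume_Ioo, sub_zero]
      _ ≤ volume _ := by
          refine measure_mono fun x hx => ?_
          have hx1 : x < 1 := lt_of_lt_of_le hx.2 h1
          exact ⟨⟨x, hx.1.le, hx1⟩, (normalQuantile_le_iff hx.1 hx1 z).2 hx.2.le, rfl⟩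

/-- The density `f_θ(x) = exp(-θ + √(2θ) Φ⁻¹(x))`, for `θ ∈ [0, 1]`; `smoothDensity 0` is the
uniform density. -/
def smoothDensity (θ : Set.Icc (0 : ℝ) 1) : Density leb where
  toFun x := Real.exp (-(θ : ℝ) + Real.sqrt (2 * θ) * normalQuantile x)
  measurable_toFun :=
    Real.measurable_exp.comp
      (measurable_const.add (measurable_const.mul measurable_normalQuantile_sample))
  nonneg _ := (Real.exp_pos _).le
  lintegral_eq_one := by
    have hm := measurable_normalQuantile_sample
    have hθ : (0 : ℝ) ≤ 2 * θ := mul_nonneg zero_le_two θ.2.1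
    have hg : Measurable fun z : ℝ =>
        ENNReal.ofReal (Real.exp (-(θ : ℝ) + Real.sqrt (2 * θ) * z)) := by fun_prop
    have hint : Integrable (fun z : ℝ => Real.exp (-(θ : ℝ) + Real.sqrt (2 * θ) * z))
        (gaussianReal 0 1) := by
      simp_rw [Real.exp_add]
      exact (integrable_exp_mul_gaussianReal _).const_mul _
    rw [← lintegral_map (μ := leb) (g := fun x : Sample => normalQuantile x) hg hm,
      map_normalQuantile,
      ← ofReal_integral_eq_lintegral_ofReal hint (ae_of_all _ fun _ => (Real.exp_pos _).le)]
    have h := congrFun (mgf_id_gaussianReal (μ := 0) (v := 1)) (Real.sqrt (2 * θ))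
    rw [mgf] at h
    simp only [id_eq] at h
    simp_rw [Real.exp_add]
    rw [integral_const_mul, h, ← Real.exp_add, Real.sq_sqrt hθ]
    simp

/-- The uniform density `f_0`. -/
abbrev uniformDensity : Density leb := smoothDensity 0

/-- The family `𝔽₀ = {f_θ : θ ∈ [0, 1]}`. -/
def smoothFamily : Set (Density leb) := Set.range smoothDensity

/-- The `j`-th of the `2N²` consecutive subintervals of `[0, 1)` of length `1 / (2N²)`. -/
def cell (N : ℕ) (j : Fin (2 * N ^ 2)) : Set Sample :=
  {x | (j : ℝ) / (2 * (N : ℝ) ^ 2) ≤ x ∧ (x : ℝ) < ((j : ℝ) + 1) / (2 * (N : ℝ) ^ 2)}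

/-- The family `𝔽_N` of densities equal to `2` on exactly `N²` of the `2N²` cells and equal to `0`
on the other ones. -/
def stepFamily (N : ℕ) : Set (Density leb) :=
  {f | ∃ S : Finset (Fin (2 * N ^ 2)), S.card = N ^ 2 ∧
    (∀ j ∈ S, ∀ x ∈ cell N j, f x = 2) ∧ (∀ j ∉ S, ∀ x ∈ cell N j, f x = 0)}

/-- The family `𝔽_△ = ⋃_{N ≥ 1} 𝔽_N`. -/
def oscillatingFamily : Set (Density leb) := ⋃ N : ℕ+, stepFamily N

/-- The model `𝔽 = 𝔽₀ ∪ 𝔽_△`. -/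
def model : Set (Density leb) := smoothFamily ∪ oscillatingFamily

/-- `f_θ` as an element of the model. -/
def smoothMember (θ : Set.Icc (0 : ℝ) 1) : model := ⟨smoothDensity θ, Or.inl ⟨θ, rfl⟩⟩

/-- An element of `𝔽_N` as an element of the model. -/
def stepMember (N : ℕ+) (g : stepFamily N) : model :=
  ⟨g, Or.inr (Set.mem_iUnion.2 ⟨N, g.2⟩)⟩

/-- The probability measure on `[0, 1]` proportional to `exp(-1/θ) dθ`. -/
def parameterPrior : Measure (Set.Icc (0 : ℝ) 1) :=
  normalizedMeasure (((volume : Measure ℝ).comap Subtype.val).withDensity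
    fun θ => ENNReal.ofReal (Real.exp (-1 / (θ : ℝ))))

/-- The component `Π₀` of the prior, carried by `𝔽₀`. -/
def smoothPrior : Measure model := parameterPrior.map smoothMember

/-- The component `Π_△` of the prior, proportional to
`∑_{N ≥ 1} N⁻² ∑_{g ∈ 𝔽_N} (2N² choose N²)⁻¹ δ_g`. -/
def oscillatingPrior : Measure model :=
  normalizedMeasure (Measure.sum fun N : ℕ+ =>
    ((N : ℝ≥0∞) ^ 2)⁻¹ • Measure.sum fun g : stepFamily N =>
      ((Nat.choose (2 * (N : ℕ) ^ 2) ((N : ℕ) ^ 2) : ℕ) : ℝ≥0∞)⁻¹ • Measure.dirac (stepMember N g))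

/-- The prior `Π = ½ Π₀ + ½ Π_△`. -/
def prior : Measure model := (2 : ℝ≥0∞)⁻¹ • smoothPrior + (2 : ℝ≥0∞)⁻¹ • oscillatingPrior

end Barron

end

/-!
Write `t = √(2θ)` and `Z = Φ⁻¹`. Under `f_θ` the variable `Z` has law `N(t, 1)`, so `𝔽₀` is a
Gaussian shift family, and its likelihood ratios depend on the data only through the mean of
the `Z(Xᵢ)`. The map `θ ↦ f_θ` is a closed embedding of `[0, 1]` into the model, and points of the model are
closed, so integrals against the prior are a `θ`-integral plus a weighted sum over `𝔽_△`
(`setLIntegral_prior`). The posterior of a set is the quotient of the integrated likelihood over the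
set and the integrated likelihood over the model; it tends to `0` once the numerator is
exponentially small and the denominator is not (`tendsto_inv_mul_zero`).

*True density in `𝔽_△`.* The prior has an atom at the truth, which bounds the denominator below. The
likelihood ratio of `f` has expectation `F(supp f⋆)ⁿ`. For `f` in `𝔽_△` at Hellinger distance more
than `ε` from `f⋆`, `F(supp f⋆)` is at most `1 - ε² / 2`; for `f` in `𝔽₀` it is at most
`1 - e⁻² / 4`, because a set of Lebesgue measure `1/2` cannot carry more mass under any `f_θ`
(`law_smoothDensity_le_of_half`). So the numerator has exponentially small expectation.

*True density `f_θ`, `θ > 0`.* The law of large numbers for `Z` shows that the denominator decays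
slower than any exponential, and that the likelihood ratios in `𝔽₀` away from `θ` are uniformly
exponentially small. For `𝔽_△` (`ae_tendsto_exp_mul_oscSum`), expectations are of no use by
themselves, since all likelihood ratios have expectation `1`. The truth gives the upper half
`[1/2, 1)` a mass `p > 1/2` (this is where `θ > 0` enters), whereas a typical member of `𝔽_N` gives
it mass about `1/2`. Fix `a > 0` with `1/2 + 2a < p`, and a large constant `L`.

* Members of `𝔽_N` whose mass of the upper half is below `1/2 + a` are refuted by the
  proportion of observations in the upper half, by an exponential Markov inequality
  (`lintegral_chernoffWeight_le`).
* The other members are an exponentially small fraction of `𝔽_N`, at most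
  `2 N² exp (-2a²N²)` (`tsum_unbalanced_le`), which suffices if `n ≤ L N²`.
* If `L N² < n`, then `𝔽_N` has at most `4 ^ N²` members, too few to compensate for the
  exponentially small probability that all observations fall into the support of a given one, so
  almost surely all these likelihood ratios vanish eventually (`ae_eventually_not_subset_cellUnion`).
-/

noncomputable section

namespace Barron

/-! ### The exponential family `f_θ` -/

lemma coe_law {X : Type*} [MeasurableSpace X] {lam : Measure X} (f : Density lam) :
    (f.law : Measure X) = lam.withDensity fun x => ENNReal.ofReal (f x) := rfl

lemma smoothDensity_apply (θ : Set.Icc (0 : ℝ) 1) (x : Sample) :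
    smoothDensity θ x = Real.exp (-(θ : ℝ) + Real.sqrt (2 * θ) * normalQuantile x) := rfl

lemma smoothDensity_pos (θ : Set.Icc (0 : ℝ) 1) (x : Sample) : 0 < smoothDensity θ x :=
  Real.exp_pos _

lemma sq_sqrt_two_mul (θ : Set.Icc (0 : ℝ) 1) : Real.sqrt (2 * θ) ^ 2 = 2 * θ :=
  Real.sq_sqrt (mul_nonneg zero_le_two θ.2.1)

lemma sqrt_two_mul_injective {θ θ' : Set.Icc (0 : ℝ) 1}
    (h : Real.sqrt (2 * θ) = Real.sqrt (2 * θ')) : θ = θ' := by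
  have := sq_sqrt_two_mul θ
  rw [h, sq_sqrt_two_mul] at this
  exact Subtype.ext (by linarith)

lemma integrable_exp_normalQuantile (t : ℝ) :
    Integrable (fun x : Sample => Real.exp (t * normalQuantile x)) leb := by
  have h := integrable_exp_mul_gaussianReal (μ := 0) (v := 1) t
  rw [← map_normalQuantile] at h
  exact h.comp_measurable measurable_normalQuantile_sample

/-- The moment generating function of the standard normal law, transported to the sample space. -/
lemma integral_exp_normalQuantile (t : ℝ) :
    ∫ x : Sample, Real.exp (t * normalQuantile x) ∂leb = Real.exp (t ^ 2 / 2) := by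
  have h := congrFun (mgf_id_gaussianReal (μ := 0) (v := 1)) t
  rw [mgf, ← map_normalQuantile,
    integral_map measurable_normalQuantile_sample.aemeasurable (by fun_prop)] at h
  simpa using h

lemma integrable_exp_add_normalQuantile (s t : ℝ) :
    Integrable (fun x : Sample => Real.exp (s + t * normalQuantile x)) leb := by
  simp_rw [Real.exp_add]
  exact (integrable_exp_normalQuantile t).const_mul _

lemma integral_exp_add_normalQuantile (s t : ℝ) :
    ∫ x : Sample, Real.exp (s + t * normalQuantile x) ∂leb = Real.exp (s + t ^ 2 / 2) := by
  simp_rw [Real.exp_add]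
  rw [integral_const_mul, integral_exp_normalQuantile]

/-- Under `f_θ` the normal quantile function has law `N(√(2θ), 1)`: the family `f_θ` is the Gaussian
shift family in disguise. -/
lemma map_normalQuantile_law (θ : Set.Icc (0 : ℝ) 1) :
    ((smoothDensity θ).law : Measure Sample).map (fun x : Sample => normalQuantile x) =
      gaussianReal (Real.sqrt (2 * θ)) 1 := by
  have hm := measurable_normalQuantile_sample
  have hg : Measurable fun z : ℝ =>
      ENNReal.ofReal (Real.exp (-(θ : ℝ) + Real.sqrt (2 * θ) * z)) := by fun_prop
  ext s hs
  rw [Measure.map_apply hm hs, coe_law, withDensity_apply _ (hm hs)]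
  simp_rw [smoothDensity_apply]
  rw [← setLIntegral_map hs hg hm, map_normalQuantile, gaussianReal_of_var_ne_zero 0 one_ne_zero,
    setLIntegral_withDensity_eq_setLIntegral_mul _ (measurable_gaussianPDF 0 1) hg hs,
    gaussianReal_apply _ one_ne_zero]
  refine setLIntegral_congr_fun hs fun z _ => ?_
  simp only [Pi.mul_apply, gaussianPDF]
  rw [← ENNReal.ofReal_mul (gaussianPDFReal_nonneg _ _ _)]
  congr 1
  rw [gaussianPDFReal, gaussianPDFReal, mul_assoc, ← Real.exp_add]
  congr 2
  have := sq_sqrt_two_mul θ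
  push_cast
  linear_combination (1 / 2) * this

lemma law_smoothDensity_injective :
    Function.Injective fun θ : Set.Icc (0 : ℝ) 1 => (smoothDensity θ).law := by
  intro θ θ' h
  have h' : ((smoothDensity θ).law : Measure Sample) = (smoothDensity θ').law :=
    congrArg (fun μ : ProbabilityMeasure Sample => (μ : Measure Sample)) h
  have h2 := map_normalQuantile_law θ
  rw [h', map_normalQuantile_law, gaussianReal_ext_iff] at h2
  exact sqrt_two_mul_injective h2.1.symm

/-- The bound `d_h² = 2 - 2ρ ≤ (√(2θ) - √(2θ'))² / 4`, as the affinity `ρ` of `f_θ` and `f_θ'` is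
`exp (-(√(2θ) - √(2θ'))² / 8)`. -/
lemma hellingerDist_smoothDensity_le (θ θ' : Set.Icc (0 : ℝ) 1) :
    Density.hellingerDist (smoothDensity θ) (smoothDensity θ') ≤
      |Real.sqrt (2 * θ) - Real.sqrt (2 * θ')| / 2 := by
  set t := Real.sqrt (2 * θ) with ht
  set u := Real.sqrt (2 * θ') with hu
  have h1 : ∀ x : Sample, (Real.sqrt (smoothDensity θ x) - Real.sqrt (smoothDensity θ' x)) ^ 2 =
      Real.exp (-(θ : ℝ) + t * normalQuantile x) + Real.exp (-(θ' : ℝ) + u * normalQuantile x)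
        - 2 * Real.exp (-((θ : ℝ) + θ') / 2 + (t + u) / 2 * normalQuantile x) := by
    intro x
    rw [sub_sq, Real.sq_sqrt (smoothDensity_pos _ _).le, Real.sq_sqrt (smoothDensity_pos _ _).le,
      mul_assoc, ← Real.sqrt_mul (smoothDensity_pos _ _).le, smoothDensity_apply,
      smoothDensity_apply, ← Real.exp_add, ← Real.exp_half]
    have : (-(θ : ℝ) + t * normalQuantile x + (-(θ' : ℝ) + u * normalQuantile x)) / 2 =
      -((θ : ℝ) + θ') / 2 + (t + u) / 2 * normalQuantile x := by ring
    rw [← ht, ← hu, this]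
    ring
  have i1 := integrable_exp_add_normalQuantile (-(θ : ℝ)) t
  have i2 := integrable_exp_add_normalQuantile (-(θ' : ℝ)) u
  have i3 := integrable_exp_add_normalQuantile (-((θ : ℝ) + θ') / 2) ((t + u) / 2)
  have i12 : Integrable (fun x : Sample => Real.exp (-(θ : ℝ) + t * normalQuantile x) +
      Real.exp (-(θ' : ℝ) + u * normalQuantile x)) leb := i1.add i2
  rw [Density.hellingerDist]
  simp_rw [h1]
  rw [integral_sub i12 (i3.const_mul 2), integral_add i1 i2, integral_const_mul,
    integral_exp_add_normalQuantile, integral_exp_add_normalQuantile,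
    integral_exp_add_normalQuantile]
  have e1 := sq_sqrt_two_mul θ
  have e2 := sq_sqrt_two_mul θ'
  rw [← ht] at e1
  rw [← hu] at e2
  refine Real.sqrt_le_iff.2 ⟨by positivity, ?_⟩
  have a1 : -(θ : ℝ) + t ^ 2 / 2 = 0 := by linarith
  have a2 : -(θ' : ℝ) + u ^ 2 / 2 = 0 := by linarith
  have a3 : -((θ : ℝ) + θ') / 2 + ((t + u) / 2) ^ 2 / 2 = -((t - u) ^ 2 / 8) := by
    linear_combination (1 / 4) * e1 + (1 / 4) * e2
  rw [a1, a2, a3, Real.exp_zero, div_pow, sq_abs]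
  have := Real.add_one_le_exp (-((t - u) ^ 2 / 8))
  linarith

/-- A set of Lebesgue measure `1/2` has probability bounded away from `1` under all `f_θ`. -/
lemma law_smoothDensity_le_of_half (θ : Set.Icc (0 : ℝ) 1) {S : Set Sample} (hS : MeasurableSet S)
    (h : leb S = 2⁻¹) :
    ((smoothDensity θ).law : Measure Sample) S ≤ ENNReal.ofReal (1 - Real.exp (-2) / 4) := by
  set a : ℝ := Real.exp (-2) / 2 with ha
  have hint : Integrable (fun x : Sample => smoothDensity θ x) leb :=
    integrable_exp_add_normalQuantile _ _
  have hint' : Integrable (fun x : Sample => (smoothDensity θ x)⁻¹) leb := by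
    simp_rw [smoothDensity_apply, ← Real.exp_neg, neg_add, ← neg_mul]
    exact integrable_exp_add_normalQuantile _ _
  have hinv : ∫ x, (smoothDensity θ x)⁻¹ ∂leb = Real.exp (2 * θ) := by
    simp_rw [smoothDensity_apply, ← Real.exp_neg, neg_add, ← neg_mul]
    rw [integral_exp_add_normalQuantile, neg_sq, sq_sqrt_two_mul]
    ring_nf
  have hScr : leb.real Sᶜ = 1 / 2 := by
    rw [measureReal_compl hS]
    simp [measureReal_def, h]; norm_num
  -- On the complement, `f ≥ 2a - a² / f` by the inequality of the means.
  have hlow : Real.exp (-2) / 4 ≤ ∫ x in Sᶜ, smoothDensity θ x ∂leb := by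
    have h1 : ∫ x in Sᶜ, (2 * a - a ^ 2 * (smoothDensity θ x)⁻¹) ∂leb ≤
        ∫ x in Sᶜ, smoothDensity θ x ∂leb := by
      refine integral_mono ((integrable_const _).sub (hint'.integrableOn.const_mul _))
        hint.integrableOn fun x => ?_
      have hp := smoothDensity_pos θ x
      have : smoothDensity θ x - (2 * a - a ^ 2 * (smoothDensity θ x)⁻¹) =
          (smoothDensity θ x - a) ^ 2 * (smoothDensity θ x)⁻¹ := by
        field_simp
        ring
      have h2 : 0 ≤ (smoothDensity θ x - a) ^ 2 * (smoothDensity θ x)⁻¹ := by positivity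
      simp only
      linarith
    have h2 : ∫ x in Sᶜ, (smoothDensity θ x)⁻¹ ∂leb ≤ Real.exp 2 := by
      refine (setIntegral_le_integral hint'
        (ae_of_all _ fun x => (inv_pos.2 (smoothDensity_pos θ x)).le)).trans ?_
      rw [hinv]
      exact Real.exp_le_exp.2 (by linarith [θ.2.2])
    rw [integral_sub (integrable_const _) (hint'.integrableOn.const_mul _),
      integral_const_mul (a ^ 2), integral_const, measureReal_restrict_apply_univ, hScr,
      smul_eq_mul] at h1
    have h3 : a ^ 2 * ∫ x in Sᶜ, (smoothDensity θ x)⁻¹ ∂leb ≤ a ^ 2 * Real.exp 2 := by gcongr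
    have h4 : a ^ 2 * Real.exp 2 = Real.exp (-2) / 4 := by
      rw [ha, div_pow, sq, ← Real.exp_add, div_mul_eq_mul_div, ← Real.exp_add]
      norm_num
    linarith
  have htot : ∫ x, smoothDensity θ x ∂leb = 1 := by
    simp_rw [smoothDensity_apply]
    rw [integral_exp_add_normalQuantile, sq_sqrt_two_mul]
    simp
  rw [coe_law, withDensity_apply _ hS, ← ofReal_integral_eq_lintegral_ofReal hint.integrableOn
    (ae_of_all _ fun x => (smoothDensity_pos θ x).le)]
  refine ENNReal.ofReal_le_ofReal ?_
  have := integral_add_compl hS hint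
  linarith

lemma normalCDF_zero : normalCDF 0 = 1 / 2 := by
  have hs : (gaussianReal 0 1) (Set.Iic 0) = (gaussianReal 0 1) (Set.Ici 0) := by
    have h := gaussianReal_map_neg (μ := 0) (v := 1)
    rw [neg_zero] at h
    conv_lhs => rw [← h]
    rw [Measure.map_apply (by fun_prop) measurableSet_Iic]
    congr 1
    ext x
    simp
  have : NullSingletonClass (gaussianReal 0 1) := nullSingletonClass_gaussianReal one_ne_zero
  have h2 : (gaussianReal 0 1).real (Set.Iic 0) + (gaussianReal 0 1).real (Set.Ioi 0) = 1 := by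
    rw [← Set.compl_Iic]
    simpa using measureReal_add_measureReal_compl (μ := gaussianReal 0 1)
      (measurableSet_Iic (a := (0 : ℝ)))
  have h3 : (gaussianReal 0 1).real (Set.Ioi 0) = (gaussianReal 0 1).real (Set.Iic 0) := by
    rw [measureReal_def, measureReal_def, hs, measure_congr Ioi_ae_eq_Ici]
  rw [normalCDF, cdf_eq_real]
  linarith

/-- The upper half of the sample space. -/
def upperHalf : Set Sample := {x | (1 : ℝ) / 2 ≤ x}

lemma measurableSet_upperHalf : MeasurableSet upperHalf :=
  measurableSet_le measurable_const measurable_subtype_coe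

lemma half_lt_law_upperHalf {θ : Set.Icc (0 : ℝ) 1} (hθ : θ ≠ 0) :
    1 / 2 < ((smoothDensity θ).law : Measure Sample).real upperHalf := by
  have ht : 0 < Real.sqrt (2 * θ) := by
    refine Real.sqrt_pos.2 (mul_pos two_pos (lt_of_le_of_ne θ.2.1 fun h => hθ (Subtype.ext h.symm)))
  set t := Real.sqrt (2 * θ)
  have hm := measurable_normalQuantile_sample
  have h1 : (gaussianReal t 1).real (Set.Ioi 0) ≤
      ((smoothDensity θ).law : Measure Sample).real upperHalf := by
    rw [← map_normalQuantile_law, map_measureReal_apply hm measurableSet_Ioi]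
    refine measureReal_mono fun x hx => ?_
    by_contra hx2
    have hx3 : (x : ℝ) < 1 / 2 := not_le.1 hx2
    have hx4 : 0 < normalQuantile x := hx
    rcases eq_or_lt_of_le x.2.1 with h0 | h0
    · have : normalQuantile x ≤ 0 := by
        rw [← h0, normalQuantile]
        have : {z : ℝ | 0 ≤ normalCDF z} = Set.univ :=
          Set.eq_univ_of_forall fun z => cdf_nonneg _ z
        rw [this, Real.sInf_univ]
      linarith
    · have := (normalQuantile_le_iff h0 x.2.2 0).2 (by rw [normalCDF_zero]; exact hx3.le)
      linarith
  refine lt_of_lt_of_le ?_ h1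
  have h2 : (gaussianReal t 1).real (Set.Ioi 0) = (gaussianReal 0 1).real (Set.Ioi (-t)) := by
    have h := gaussianReal_map_add_const (μ := 0) (v := 1) t
    rw [zero_add] at h
    rw [← h, map_measureReal_apply (by fun_prop) measurableSet_Ioi]
    congr 1
    ext x
    simp [neg_lt_iff_pos_add]
  have h3 : (gaussianReal 0 1).real (Set.Ioi (-t)) =
      (gaussianReal 0 1).real (Set.Ioc (-t) 0) + (gaussianReal 0 1).real (Set.Ioi 0) := by
    rw [← measureReal_union (Set.Ioc_disjoint_Ioi le_rfl) measurableSet_Ioi,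
      Set.Ioc_union_Ioi_eq_Ioi (by linarith)]
  have h4 : (gaussianReal 0 1).real (Set.Ioi 0) = 1 / 2 := by
    rw [← Set.compl_Iic, probReal_compl_eq_one_sub measurableSet_Iic, ← cdf_eq_real]
    have := normalCDF_zero
    rw [normalCDF] at this
    rw [this]; norm_num
  have h5 : 0 < (gaussianReal 0 1).real (Set.Ioc (-t) 0) := by
    rw [measureReal_def, ENNReal.toReal_pos_iff]
    refine ⟨pos_iff_ne_zero.2 fun h0 => ?_, measure_lt_top _ _⟩
    have := gaussianReal_absolutelyContinuous' 0 one_ne_zero h0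
    rw [Real.volume_Ioc] at this
    simp at this
    linarith
  rw [h2, h3, h4]
  linarith

/-! ### Step densities -/

lemma leb_Ico {a b : ℝ} (ha : 0 ≤ a) (hb : b ≤ 1) :
    leb {x : Sample | a ≤ x ∧ (x : ℝ) < b} = ENNReal.ofReal (b - a) := by
  rw [leb, comap_subtype_coe_apply measurableSet_Ico, ← Real.volume_Ico]
  congr 1
  ext x
  constructor
  · rintro ⟨y, hy, rfl⟩
    exact hy
  · rintro ⟨h1, h2⟩
    exact ⟨⟨x, ha.trans h1, h2.trans_le hb⟩, ⟨h1, h2⟩, rfl⟩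

/-- The union of the cells with index in `S`. -/
def cellUnion (N : ℕ) (S : Finset (Fin (2 * N ^ 2))) : Set Sample := ⋃ j ∈ S, cell N j

lemma mem_cellUnion {N : ℕ} {S : Finset (Fin (2 * N ^ 2))} {x : Sample} :
    x ∈ cellUnion N S ↔ ∃ j ∈ S, x ∈ cell N j := by
  simp [cellUnion]

lemma measurableSet_cell (N : ℕ) (j : Fin (2 * N ^ 2)) : MeasurableSet (cell N j) :=
  (measurableSet_le measurable_const measurable_subtype_coe).inter
    (measurableSet_lt measurable_subtype_coe measurable_const)

lemma measurableSet_cellUnion (N : ℕ) (S : Finset (Fin (2 * N ^ 2))) :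
    MeasurableSet (cellUnion N S) :=
  S.measurableSet_biUnion fun j _ => measurableSet_cell N j

lemma mem_cell_iff {N : ℕ} {j : Fin (2 * N ^ 2)} {x : Sample} :
    x ∈ cell N j ↔ ⌊(2 * (N : ℝ) ^ 2) * x⌋₊ = j := by
  have hN : 0 < 2 * N ^ 2 := j.pos
  have hN' : (0 : ℝ) < 2 * (N : ℝ) ^ 2 := by exact_mod_cast hN
  rw [Nat.floor_eq_iff (mul_nonneg hN'.le x.2.1), cell, Set.mem_ofPred_eq, div_le_iff₀' hN',
    lt_div_iff₀' hN']

lemma exists_mem_cell {N : ℕ} (hN : 0 < N) (x : Sample) : ∃ j, x ∈ cell N j := by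
  have hN' : (0 : ℝ) < 2 * (N : ℝ) ^ 2 := by positivity
  have h : ⌊(2 * (N : ℝ) ^ 2) * x⌋₊ < 2 * N ^ 2 := by
    rw [Nat.floor_lt (mul_nonneg hN'.le x.2.1)]
    push_cast
    exact mul_lt_of_lt_one_right hN' x.2.2
  exact ⟨⟨_, h⟩, mem_cell_iff.2 rfl⟩

lemma eq_of_mem_cell {N : ℕ} {i j : Fin (2 * N ^ 2)} {x : Sample} (hi : x ∈ cell N i)
    (hj : x ∈ cell N j) : i = j :=
  Fin.ext ((mem_cell_iff.1 hi).symm.trans (mem_cell_iff.1 hj))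

lemma leb_cell {N : ℕ} (j : Fin (2 * N ^ 2)) : leb (cell N j) = (2 * (N : ℝ≥0∞) ^ 2)⁻¹ := by
  have hN : 0 < 2 * N ^ 2 := j.pos
  have hN' : (0 : ℝ) < 2 * (N : ℝ) ^ 2 := by exact_mod_cast hN
  have hj : (j : ℝ) + 1 ≤ 2 * (N : ℝ) ^ 2 := by exact_mod_cast j.2
  rw [cell, leb_Ico (by positivity) ((div_le_one hN').2 hj), ← sub_div, add_sub_cancel_left,
    one_div, ENNReal.ofReal_inv_of_pos hN', ENNReal.ofReal_mul two_pos.le,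
    ENNReal.ofReal_pow (Nat.cast_nonneg _)]
  simp

lemma leb_cellUnion (N : ℕ) (S : Finset (Fin (2 * N ^ 2))) :
    leb (cellUnion N S) = S.card * (2 * (N : ℝ≥0∞) ^ 2)⁻¹ := by
  rw [cellUnion, measure_biUnion_finset _ fun j _ => measurableSet_cell N j]
  · simp_rw [leb_cell]
    simp
  · intro i _ j _ hij
    exact Set.disjoint_left.2 fun x hi hj => hij (eq_of_mem_cell hi hj)

lemma leb_cellUnion_of_card_eq {N : ℕ} (hN : 0 < N) {S : Finset (Fin (2 * N ^ 2))}
    (hS : S.card = N ^ 2) : leb (cellUnion N S) = 2⁻¹ := by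
  have h0 : ((N : ℝ≥0∞) ^ 2) ≠ 0 := by simp [hN.ne']
  have h1 : ((N : ℝ≥0∞) ^ 2) ≠ ∞ := by simp
  rw [leb_cellUnion, hS, ENNReal.mul_inv (Or.inl two_ne_zero) (Or.inl ENNReal.ofNat_ne_top),
    mul_comm, mul_assoc]
  push_cast
  rw [ENNReal.inv_mul_cancel h0 h1, mul_one]

/-- The cells in the upper half of the sample space. -/
def upperCells (N : ℕ) : Finset (Fin (2 * N ^ 2)) :=
  Finset.univ.filter fun j : Fin (2 * N ^ 2) => N ^ 2 ≤ (j : ℕ)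

lemma card_upperCells (N : ℕ) : (upperCells N).card = N ^ 2 := by
  have h : upperCells N = Finset.univ.filter fun j : Fin (2 * N ^ 2) => ¬ (j : ℕ) < N ^ 2 := by
    simp [upperCells]
  have h1 := Finset.card_filter_add_card_filter_not (s := (Finset.univ : Finset (Fin (2 * N ^ 2))))
    (fun j => (j : ℕ) < N ^ 2)
  rw [← h, Fin.card_filter_val_lt, Finset.card_univ, Fintype.card_fin] at h1
  omega

lemma cellUnion_inter_upperHalf (N : ℕ) (S : Finset (Fin (2 * N ^ 2))) :
    cellUnion N S ∩ upperHalf = cellUnion N (S ∩ upperCells N) := by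
  have key : ∀ (j : Fin (2 * N ^ 2)) (x : Sample), x ∈ cell N j →
      (x ∈ upperHalf ↔ N ^ 2 ≤ (j : ℕ)) := by
    intro j x hx
    have hN : 0 < 2 * N ^ 2 := j.pos
    have hN' : (0 : ℝ) < 2 * (N : ℝ) ^ 2 := by exact_mod_cast hN
    rw [← mem_cell_iff.1 hx, Nat.le_floor_iff (mul_nonneg hN'.le x.2.1), upperHalf,
      Set.mem_ofPred_eq]
    push_cast
    constructor <;> intro h <;> nlinarith
  ext x
  simp only [Set.mem_inter_iff, mem_cellUnion, Finset.mem_inter, upperCells, Finset.mem_filter,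
    Finset.mem_univ, true_and]
  constructor
  · rintro ⟨⟨j, hj, hx⟩, hu⟩
    exact ⟨j, ⟨hj, (key j x hx).1 hu⟩, hx⟩
  · rintro ⟨j, ⟨hj, hu⟩, hx⟩
    exact ⟨⟨j, hj, hx⟩, (key j x hx).2 hu⟩

/-- The set of cells on which a step density is positive. -/
def cells {N : ℕ} (g : stepFamily N) : Finset (Fin (2 * N ^ 2)) := g.2.choose

lemma card_cells {N : ℕ} (g : stepFamily N) : (cells g).card = N ^ 2 := g.2.choose_spec.1

lemma step_apply_of_mem {N : ℕ} (g : stepFamily N) {x : Sample}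
    (hx : x ∈ cellUnion N (cells g)) : (g : Density leb) x = 2 := by
  obtain ⟨j, hj, hx⟩ := mem_cellUnion.1 hx
  exact g.2.choose_spec.2.1 j hj x hx

lemma step_apply_of_notMem {N : ℕ} (hN : 0 < N) (g : stepFamily N) {x : Sample}
    (hx : x ∉ cellUnion N (cells g)) : (g : Density leb) x = 0 := by
  obtain ⟨j, hj⟩ := exists_mem_cell hN x
  exact g.2.choose_spec.2.2 j (fun h => hx (mem_cellUnion.2 ⟨j, h, hj⟩)) x hj

lemma ofReal_step_eq_indicator {N : ℕ} (hN : 0 < N) (g : stepFamily N) :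
    (fun x => ENNReal.ofReal ((g : Density leb) x)) =
      (cellUnion N (cells g)).indicator fun _ => 2 := by
  ext x
  by_cases hx : x ∈ cellUnion N (cells g)
  · rw [step_apply_of_mem g hx, Set.indicator_of_mem hx]; simp
  · rw [step_apply_of_notMem hN g hx, Set.indicator_of_notMem hx]; simp

lemma law_step_apply {N : ℕ} (hN : 0 < N) (g : stepFamily N) (A : Set Sample) :
    ((g : Density leb).law : Measure Sample) A = 2 * leb (cellUnion N (cells g) ∩ A) := by
  rw [coe_law, withDensity_apply' _ A, ofReal_step_eq_indicator hN,
    setLIntegral_indicator (measurableSet_cellUnion N _), setLIntegral_const]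

lemma density_ext {f g : Density leb} (h : ∀ x, f x = g x) : f = g := by
  cases f; cases g
  congr
  exact funext h

lemma cells_injective {N : ℕ} (hN : 0 < N) : Function.Injective (cells (N := N)) := by
  intro f g h
  refine Subtype.ext (density_ext fun x => ?_)
  by_cases hx : x ∈ cellUnion N (cells f)
  · rw [step_apply_of_mem f hx, step_apply_of_mem g (h ▸ hx)]
  · rw [step_apply_of_notMem hN f hx, step_apply_of_notMem hN g (h ▸ hx)]

lemma finite_stepFamily (N : ℕ+) : Finite (stepFamily N) :=
  Finite.of_injective _ (cells_injective N.pos)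

/-! ### The topology of the model -/

/-- Step densities are locally constant from the right. -/
lemma exists_eqOn_right {N : ℕ} (hN : 0 < N) (g : stepFamily N) (x : Sample) :
    ∃ b : ℝ, x < b ∧ b ≤ 1 ∧ ∀ y : Sample, x ≤ y → (y : ℝ) < b →
      (g : Density leb) y = (g : Density leb) x := by
  obtain ⟨j, hj⟩ := exists_mem_cell hN x
  have hN' : (0 : ℝ) < 2 * (N : ℝ) ^ 2 := by positivity
  have hj1 : (j : ℝ) + 1 ≤ 2 * (N : ℝ) ^ 2 := by exact_mod_cast j.2
  refine ⟨((j : ℝ) + 1) / (2 * (N : ℝ) ^ 2), hj.2, (div_le_one hN').2 hj1, fun y hxy hy => ?_⟩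
  have hyj : y ∈ cell N j := ⟨hj.1.trans hxy, hy⟩
  by_cases hS : j ∈ cells g
  · rw [step_apply_of_mem g (mem_cellUnion.2 ⟨j, hS, hj⟩),
      step_apply_of_mem g (mem_cellUnion.2 ⟨j, hS, hyj⟩)]
  · have h : ∀ z ∈ cell N j, z ∉ cellUnion N (cells g) := by
      intro z hz hmem
      obtain ⟨i, hi, hzi⟩ := mem_cellUnion.1 hmem
      exact hS (eq_of_mem_cell hzi hz ▸ hi)
    rw [step_apply_of_notMem hN g (h x hj), step_apply_of_notMem hN g (h y hyj)]

lemma ae_eq_of_law_eq {f g : Density leb} (h : f.law = g.law) : ∀ᵐ x ∂leb, f x = g x := by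
  have h' : (f.law : Measure Sample) = g.law :=
    congrArg (fun μ : ProbabilityMeasure Sample => (μ : Measure Sample)) h
  rw [coe_law, coe_law, withDensity_eq_iff f.measurable_toFun.ennreal_ofReal.aemeasurable
    g.measurable_toFun.ennreal_ofReal.aemeasurable (by rw [f.lintegral_eq_one]; simp)] at h'
  filter_upwards [h'] with x hx
  exact (ENNReal.ofReal_eq_ofReal_iff (f.nonneg x) (g.nonneg x)).1 hx

/-- Step densities which agree almost everywhere agree everywhere, by right-continuity. -/
lemma step_eq_of_law_eq {N M : ℕ} (hN : 0 < N) (hM : 0 < M) (f : stepFamily N) (g : stepFamily M)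
    (h : (f : Density leb).law = (g : Density leb).law) : (f : Density leb) = g := by
  refine density_ext fun x => ?_
  obtain ⟨b, hb, hb1, hbf⟩ := exists_eqOn_right hN f x
  obtain ⟨c, hc, hc1, hcg⟩ := exists_eqOn_right hM g x
  by_contra hne
  have h0 := ae_iff.1 (ae_eq_of_law_eq h)
  have hsub : {y : Sample | (x : ℝ) ≤ y ∧ (y : ℝ) < min b c} ⊆
      {y | ¬ (f : Density leb) y = (g : Density leb) y} := by
    rintro y ⟨h1, h2⟩
    rw [Set.mem_ofPred_eq, hbf y h1 (h2.trans_le (min_le_left _ _)),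
      hcg y h1 (h2.trans_le (min_le_right _ _))]
    exact hne
  have h1 := measure_mono_null hsub h0
  rw [leb_Ico x.2.1 (min_le_of_left_le hb1), ENNReal.ofReal_eq_zero] at h1
  exact absurd h1 (not_le.2 (sub_pos.2 (lt_min hb hc)))

/-- Smooth densities are positive, step densities vanish on a set of measure `1/2`. -/
lemma law_smooth_ne_law_step {N : ℕ} (hN : 0 < N) (θ : Set.Icc (0 : ℝ) 1) (g : stepFamily N) :
    (smoothDensity θ).law ≠ (g : Density leb).law := by
  intro h
  have h0 := ae_iff.1 (ae_eq_of_law_eq h)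
  have hsub : (cellUnion N (cells g))ᶜ ⊆ {x | ¬ smoothDensity θ x = (g : Density leb) x} := by
    intro x hx
    rw [Set.mem_ofPred_eq, step_apply_of_notMem hN g hx]
    exact (smoothDensity_pos θ x).ne'
  have h1 := measure_mono_null hsub h0
  rw [prob_compl_eq_zero_iff (measurableSet_cellUnion _ _),
    leb_cellUnion_of_card_eq hN (card_cells g)] at h1
  simp at h1

lemma model_cases (f : model) :
    (∃ θ, f = smoothMember θ) ∨ ∃ (N : ℕ+) (g : stepFamily N), f = stepMember N g := by
  obtain ⟨f, ⟨θ, rfl⟩ | hf⟩ := f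
  · exact Or.inl ⟨θ, rfl⟩
  · obtain ⟨N, hN⟩ := Set.mem_iUnion.1 hf
    exact Or.inr ⟨N, ⟨f, hN⟩, rfl⟩

lemma law_injective_model : Function.Injective fun f : model => (f : Density leb).law := by
  intro f g h
  rcases model_cases f with ⟨θ, rfl⟩ | ⟨N, f, rfl⟩ <;>
    rcases model_cases g with ⟨θ', rfl⟩ | ⟨M, g, rfl⟩
  · rw [law_smoothDensity_injective h]
  · exact absurd h (law_smooth_ne_law_step M.pos θ g)
  · exact absurd h.symm (law_smooth_ne_law_step N.pos θ' f)
  · exact Subtype.ext (step_eq_of_law_eq N.pos M.pos f g h)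

lemma continuous_law : Continuous fun f : Density leb => f.law := continuous_induced_dom

/-- The model inherits the Hausdorff property from the weak topology, since its members are
determined by their laws. For `Density leb` itself this fails. -/
instance : T2Space model :=
  T2Space.of_injective_continuous law_injective_model
    (continuous_law.comp continuous_subtype_val)

lemma continuous_law_smoothDensity :
    Continuous fun θ : Set.Icc (0 : ℝ) 1 => (smoothDensity θ).law := by
  have hm := measurable_normalQuantile_sample
  refine continuous_iff_continuousAt.2 fun θ₀ =>
    ProbabilityMeasure.tendsto_iff_forall_integral_tendsto.2 fun h => ?_
  have key : ∀ θ : Set.Icc (0 : ℝ) 1, ∫ x, h x ∂((smoothDensity θ).law : Measure Sample) =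
      ∫ x, smoothDensity θ x * h x ∂leb := by
    intro θ
    rw [coe_law, integral_withDensity_eq_integral_toReal_smul
      (smoothDensity θ).measurable_toFun.ennreal_ofReal
      (ae_of_all _ fun _ => ENNReal.ofReal_lt_top)]
    simp_rw [ENNReal.toReal_ofReal ((smoothDensity θ).nonneg _), smul_eq_mul]
  simp_rw [key]
  have hcont : Continuous fun θ : Set.Icc (0 : ℝ) 1 => ∫ x, smoothDensity θ x * h x ∂leb := by
    refine continuous_of_dominated (bound := fun x : Sample =>
      (Real.exp (Real.sqrt 2 * normalQuantile x) + Real.exp (-Real.sqrt 2 * normalQuantile x)) *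
        ‖h‖) (fun θ => ?_) (fun θ => ae_of_all _ fun x => ?_) ?_ (ae_of_all _ fun x => ?_)
    · exact ((smoothDensity θ).measurable_toFun.mul
        h.continuous.measurable).aestronglyMeasurable
    · rw [norm_mul, Real.norm_of_nonneg ((smoothDensity θ).nonneg x), smoothDensity_apply]
      gcongr
      · have h1 : Real.sqrt (2 * θ) ≤ Real.sqrt 2 := Real.sqrt_le_sqrt (by linarith [θ.2.2])
        have h2 := Real.sqrt_nonneg (2 * θ)
        have h3 := θ.2.1
        rcases le_total 0 (normalQuantile x) with hz | hz
        · exact (Real.exp_le_exp.2 (by nlinarith)).trans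
            (le_add_of_nonneg_right (Real.exp_pos _).le)
        · exact (Real.exp_le_exp.2 (by nlinarith)).trans
            (le_add_of_nonneg_left (Real.exp_pos _).le)
      · exact h.norm_coe_le_norm x
    · exact ((integrable_exp_normalQuantile _).add (integrable_exp_normalQuantile _)).mul_const _
    · simp_rw [smoothDensity_apply]
      fun_prop
  exact hcont.tendsto θ₀

lemma continuous_smoothDensity : Continuous smoothDensity :=
  continuous_induced_rng.2 (show Continuous (Density.law ∘ smoothDensity) from
    continuous_law_smoothDensity)

lemma smoothMember_injective : Function.Injective smoothMember := by
  intro θ θ' h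
  have h1 : smoothDensity θ = smoothDensity θ' := congrArg Subtype.val h
  refine law_smoothDensity_injective ?_
  change (smoothDensity θ).law = (smoothDensity θ').law
  rw [h1]

/-- Measurability of `θ ↦ f_θ` keeps the image measure `Π₀` from being the junk value `0`, and the
embedding property allows integration of arbitrary functions against it. -/
lemma measurableEmbedding_smoothMember : MeasurableEmbedding smoothMember := by
  have hc : Continuous smoothMember := continuous_smoothDensity.subtype_mk _
  exact (hc.isClosedEmbedding smoothMember_injective).measurableEmbedding

end Barron

/-! ### Likelihood ratios of independent observations -/

namespace Density

section General

variable {X : Type*} [MeasurableSpace X] {lam : Measure X}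

/-- The law of a sequence of i.i.d. observations from the density `f`. -/
def obs (f : Density lam) : Measure (ℕ → X) := Measure.infinitePi fun _ : ℕ => (f.law : Measure X)

instance (f : Density lam) : IsProbabilityMeasure f.obs := by
  unfold obs; infer_instance

lemma ofReal_likelihoodRatio (fstar f : Density lam) (n : ℕ) (x : ℕ → X) :
    ENNReal.ofReal (likelihoodRatio fstar f n x) =
      ∏ i ∈ Finset.range n, ENNReal.ofReal (f (x i) / fstar (x i)) :=
  ENNReal.ofReal_prod_of_nonneg fun _ _ => div_nonneg (f.nonneg _) (fstar.nonneg _)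

lemma measurable_ofReal_likelihoodRatio (fstar f : Density lam) (n : ℕ) :
    Measurable fun x : ℕ → X => ENNReal.ofReal (likelihoodRatio fstar f n x) := by
  refine ENNReal.measurable_ofReal.comp (Finset.measurable_fun_prod _ fun i _ => ?_)
  exact (f.measurable_toFun.comp (measurable_pi_apply i)).div
    (fstar.measurable_toFun.comp (measurable_pi_apply i))

lemma lintegral_obs_prod (f : Density lam) {φ : X → ℝ≥0∞} (hφ : Measurable φ) (n : ℕ) :
    ∫⁻ x, ∏ i ∈ Finset.range n, φ (x i) ∂f.obs = (∫⁻ y, φ y ∂(f.law : Measure X)) ^ n := by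
  have hind : iIndepFun (fun (i : ℕ) (x : ℕ → X) => φ (x i)) f.obs :=
    iIndepFun_infinitePi (X := fun _ => φ) fun _ => hφ
  rw [lintegral_prod_eq_prod_lintegral_of_indepFun _ _ hind fun i =>
    hφ.comp (measurable_pi_apply i)]
  have h : ∀ i : ℕ, ∫⁻ x, φ (x i) ∂f.obs = ∫⁻ y, φ y ∂(f.law : Measure X) := fun i => by
    rw [← lintegral_map hφ (measurable_pi_apply i)]
    exact congrArg (fun μ => lintegral μ φ)
      (Measure.infinitePi_map_eval (fun _ : ℕ => (f.law : Measure X)) i)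
  simp [h]

lemma lintegral_mul_ratio (fstar f : Density lam) {φ : X → ℝ≥0∞} (hφ : Measurable φ) :
    ∫⁻ y, φ y * ENNReal.ofReal (f y / fstar y) ∂(fstar.law : Measure X) =
      ∫⁻ y in {y | fstar y ≠ 0}, φ y ∂(f.law : Measure X) := by
  have hA : MeasurableSet {y | fstar y ≠ 0} :=
    (measurableSet_eq_fun fstar.measurable_toFun measurable_const).compl
  have hr : Measurable fun y => φ y * ENNReal.ofReal (f y / fstar y) :=
    hφ.mul (f.measurable_toFun.div fstar.measurable_toFun).ennreal_ofReal
  rw [Barron.coe_law, Barron.coe_law,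
    lintegral_withDensity_eq_lintegral_mul _ fstar.measurable_toFun.ennreal_ofReal hr,
    setLIntegral_withDensity_eq_setLIntegral_mul _ f.measurable_toFun.ennreal_ofReal hφ hA,
    ← lintegral_indicator hA]
  refine lintegral_congr fun y => ?_
  by_cases hy : fstar y = 0
  · simp [hy]
  · rw [Set.indicator_of_mem (by exact hy)]
    simp only [Pi.mul_apply]
    rw [mul_left_comm, ← ENNReal.ofReal_mul (fstar.nonneg y), mul_div_cancel₀ _ hy, mul_comm]

/-- Expectations of weighted likelihood ratios reduce to one-observation integrals against the
alternative. -/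
lemma lintegral_prod_mul_likelihoodRatio (fstar f : Density lam) {φ : X → ℝ≥0∞}
    (hφ : Measurable φ) (n : ℕ) :
    ∫⁻ x, (∏ i ∈ Finset.range n, φ (x i)) * ENNReal.ofReal (likelihoodRatio fstar f n x)
      ∂fstar.obs = (∫⁻ y in {y | fstar y ≠ 0}, φ y ∂(f.law : Measure X)) ^ n := by
  simp_rw [ofReal_likelihoodRatio, ← Finset.prod_mul_distrib]
  rw [lintegral_obs_prod fstar (φ := fun y => φ y * ENNReal.ofReal (f y / fstar y))
    (hφ.mul (f.measurable_toFun.div fstar.measurable_toFun).ennreal_ofReal),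
    lintegral_mul_ratio _ _ hφ]

lemma lintegral_likelihoodRatio (fstar f : Density lam) (n : ℕ) :
    ∫⁻ x, ENNReal.ofReal (likelihoodRatio fstar f n x) ∂fstar.obs =
      ((f.law : Measure X) {y | fstar y ≠ 0}) ^ n := by
  have h := lintegral_prod_mul_likelihoodRatio fstar f (φ := fun _ => 1) measurable_const n
  simpa using h

lemma lintegral_likelihoodRatio_le_one (fstar f : Density lam) (n : ℕ) :
    ∫⁻ x, ENNReal.ofReal (likelihoodRatio fstar f n x) ∂fstar.obs ≤ 1 := by
  rw [lintegral_likelihoodRatio]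
  exact pow_le_one₀ zero_le prob_le_one

lemma ae_obs_of_ae_law (f : Density lam) {p : X → Prop}
    (h : ∀ᵐ y ∂(f.law : Measure X), p y) : ∀ᵐ x ∂f.obs, ∀ i, p (x i) := by
  rw [ae_all_iff]
  intro i
  exact (measurePreserving_eval_infinitePi (fun _ : ℕ => (f.law : Measure X))
    i).quasiMeasurePreserving.ae h

lemma strong_law (f : Density lam) {φ : X → ℝ} (hm : Measurable φ)
    (hφ : Integrable φ (f.law : Measure X)) :
    ∀ᵐ x ∂f.obs, Tendsto (fun n : ℕ => (∑ i ∈ Finset.range n, φ (x i)) / n) atTop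
      (𝓝 (∫ y, φ y ∂(f.law : Measure X))) := by
  have hpres := measurePreserving_eval_infinitePi (fun _ : ℕ => (f.law : Measure X))
  have hind : iIndepFun (fun (i : ℕ) (x : ℕ → X) => φ (x i)) f.obs :=
    iIndepFun_infinitePi (X := fun _ => φ) fun _ => hm
  have hmap : ∀ i : ℕ, f.obs.map (fun x => φ (x i)) = (f.law : Measure X).map φ := by
    intro i
    rw [← (hpres i).map_eq, Measure.map_map hm (measurable_pi_apply i)]
    rfl
  have h := strong_law_ae_real (μ := f.obs) (fun (i : ℕ) (x : ℕ → X) => φ (x i))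
    ((hpres 0).integrable_comp_of_integrable hφ) (fun i j hij => hind.indepFun hij)
    (fun i => ⟨(hm.comp (measurable_pi_apply i)).aemeasurable,
      (hm.comp (measurable_pi_apply 0)).aemeasurable, by rw [hmap, hmap]⟩)
  have h0 : ∫ x, φ (x 0) ∂f.obs = ∫ y, φ y ∂(f.law : Measure X) := by
    rw [← integral_map (measurable_pi_apply 0).aemeasurable
      (by exact hm.aestronglyMeasurable)]
    exact congrArg (fun μ => integral μ φ) (hpres 0).map_eq
  rw [h0] at h
  exact h

end General

end Density

/-! ### Exponentially small random sequences -/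

lemma ae_tendsto_zero_of_tsum_lintegral_ne_top {Ω : Type*} [MeasurableSpace Ω] {μ : Measure Ω}
    {Y : ℕ → Ω → ℝ≥0∞} (hY : ∀ n, Measurable (Y n)) (h : ∑' n, ∫⁻ ω, Y n ω ∂μ ≠ ∞) :
    ∀ᵐ ω ∂μ, Tendsto (fun n => Y n ω) atTop (𝓝 0) := by
  rw [← lintegral_tsum fun n => (hY n).aemeasurable] at h
  filter_upwards [ae_lt_top (Measurable.tsum hY) h] with ω hω
  exact ENNReal.tendsto_atTop_zero_of_tsum_ne_top hω.ne

lemma tsum_ofReal_exp_ne_top {δ : ℝ} (hδ : 0 < δ) :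
    ∑' n : ℕ, ENNReal.ofReal (Real.exp (-(δ * n))) ≠ ∞ := by
  have h : Summable fun n : ℕ => Real.exp (-(δ * n)) := by
    have := Real.summable_exp_nat_mul_iff.2 (neg_neg_of_pos hδ)
    refine this.congr fun n => ?_
    congr 1
    ring
  exact h.tsum_ofReal_ne_top

/-- A random sequence with expectations `O(exp (-2δn))` is almost surely `o(exp (-δn))`. -/
lemma ae_tendsto_exp_mul_zero {Ω : Type*} [MeasurableSpace Ω] {μ : Measure Ω}
    {Y : ℕ → Ω → ℝ≥0∞} (hY : ∀ n, Measurable (Y n)) {C : ℝ≥0∞} (hC : C ≠ ∞) {δ : ℝ} (hδ : 0 < δ)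
    (h : ∀ n : ℕ, ∫⁻ ω, Y n ω ∂μ ≤ C * ENNReal.ofReal (Real.exp (-(2 * δ * n)))) :
    ∀ᵐ ω ∂μ, Tendsto (fun n : ℕ => ENNReal.ofReal (Real.exp (δ * n)) * Y n ω) atTop (𝓝 0) := by
  refine ae_tendsto_zero_of_tsum_lintegral_ne_top (fun n => (hY n).const_mul _) ?_
  refine ne_top_of_le_ne_top (ENNReal.mul_ne_top hC (tsum_ofReal_exp_ne_top hδ)) ?_
  rw [← ENNReal.tsum_mul_left]
  refine ENNReal.tsum_le_tsum fun n => ?_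
  rw [lintegral_const_mul _ (hY n)]
  calc _ ≤ ENNReal.ofReal (Real.exp (δ * n)) *
        (C * ENNReal.ofReal (Real.exp (-(2 * δ * n)))) := by gcongr; exact h n
    _ = C * ENNReal.ofReal (Real.exp (-(δ * n))) := by
      rw [mul_left_comm, ← ENNReal.ofReal_mul (Real.exp_pos _).le, ← Real.exp_add]
      congr 3
      ring

/-- A ratio tends to `0` if the numerator beats the lower bound on the denominator. -/
lemma tendsto_inv_mul_zero {D Y : ℕ → ℝ≥0∞} {c : ℝ≥0∞} (hc : c ≠ 0) {δ : ℝ}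
    (hD : ∀ᶠ n : ℕ in atTop, c * ENNReal.ofReal (Real.exp (-(δ * n))) ≤ D n)
    (hY : Tendsto (fun n : ℕ => ENNReal.ofReal (Real.exp (δ * n)) * Y n) atTop (𝓝 0)) :
    Tendsto (fun n => (D n)⁻¹ * Y n) atTop (𝓝 0) := by
  have h1 : Tendsto (fun n : ℕ => c⁻¹ * (ENNReal.ofReal (Real.exp (δ * n)) * Y n)) atTop
      (𝓝 0) := by
    have := ENNReal.Tendsto.const_mul (a := c⁻¹) hY (Or.inr (ENNReal.inv_ne_top.2 hc))
    rwa [mul_zero] at this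
  refine tendsto_of_tendsto_of_tendsto_of_le_of_le' tendsto_const_nhds h1
    (Eventually.of_forall fun _ => zero_le) ?_
  filter_upwards [hD] with n hn
  rw [← mul_assoc]
  gcongr
  refine (ENNReal.inv_le_inv.2 hn).trans ?_
  rw [ENNReal.mul_inv (Or.inl hc) (Or.inr (by positivity)), Real.exp_neg,
    ENNReal.ofReal_inv_of_pos (Real.exp_pos _), inv_inv]

/-! ### Integration against the prior -/

namespace Barron

/-- The weight of `𝔽_N` in the oscillating prior, before normalization. -/
def levelWeight (N : ℕ+) : ℝ≥0∞ := ((N : ℝ≥0∞) ^ 2)⁻¹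

/-- The weight of a single density of `𝔽_N` within `𝔽_N`. -/
def stepWeight (N : ℕ+) : ℝ≥0∞ :=
  ((Nat.choose (2 * (N : ℕ) ^ 2) ((N : ℕ) ^ 2) : ℕ) : ℝ≥0∞)⁻¹

/-- Summation of `a` against the unnormalized oscillating prior. -/
def oscSum (a : (N : ℕ+) → stepFamily N → ℝ≥0∞) : ℝ≥0∞ :=
  ∑' N : ℕ+, levelWeight N * ∑' g : stepFamily N, stepWeight N * a N g

lemma oscSum_mono {a b : (N : ℕ+) → stepFamily N → ℝ≥0∞} (h : ∀ N g, a N g ≤ b N g) :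
    oscSum a ≤ oscSum b := by
  unfold oscSum
  gcongr with N g
  exact h N g

lemma oscSum_add (a b : (N : ℕ+) → stepFamily N → ℝ≥0∞) :
    oscSum (fun N g => a N g + b N g) = oscSum a + oscSum b := by
  simp only [oscSum, mul_add, ENNReal.tsum_add]

lemma oscSum_const_mul (c : ℝ≥0∞) (a : (N : ℕ+) → stepFamily N → ℝ≥0∞) :
    oscSum (fun N g => c * a N g) = c * oscSum a := by
  simp only [oscSum, ← ENNReal.tsum_mul_left]
  simp only [mul_left_comm _ c]

lemma le_oscSum (a : (N : ℕ+) → stepFamily N → ℝ≥0∞) (N : ℕ+) (g : stepFamily N) :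
    levelWeight N * (stepWeight N * a N g) ≤ oscSum a := by
  refine le_trans ?_ (ENNReal.le_tsum N)
  gcongr
  exact ENNReal.le_tsum (f := fun g => stepWeight N * a N g) g

lemma measurable_oscSum {Ω : Type*} [MeasurableSpace Ω]
    {a : Ω → (N : ℕ+) → stepFamily N → ℝ≥0∞} (h : ∀ N g, Measurable fun ω => a ω N g) :
    Measurable fun ω => oscSum (a ω) := by
  have := finite_stepFamily
  refine Measurable.tsum fun N => Measurable.const_mul ?_ _
  exact Measurable.tsum fun g => (h N g).const_mul _

lemma lintegral_oscSum {Ω : Type*} [MeasurableSpace Ω] {μ : Measure Ω}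
    {a : Ω → (N : ℕ+) → stepFamily N → ℝ≥0∞} (h : ∀ N g, Measurable fun ω => a ω N g) :
    ∫⁻ ω, oscSum (a ω) ∂μ = oscSum fun N g => ∫⁻ ω, a ω N g ∂μ := by
  have := finite_stepFamily
  have h1 : ∀ N : ℕ+, Measurable fun ω => ∑' g : stepFamily N, stepWeight N * a ω N g :=
    fun N => Measurable.tsum fun g => (h N g).const_mul _
  unfold oscSum
  rw [lintegral_tsum fun N => ((h1 N).const_mul _).aemeasurable]
  congr 1
  ext N
  rw [lintegral_const_mul _ (h1 N), lintegral_tsum fun g => ((h N g).const_mul _).aemeasurable]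
  congr 2
  ext g
  rw [lintegral_const_mul _ (h N g)]

/-- The total mass of the unnormalized oscillating prior. -/
def oscMass : ℝ≥0∞ := oscSum fun _ _ => 1

lemma stepWeight_ne_zero (N : ℕ+) : stepWeight N ≠ 0 :=
  ENNReal.inv_ne_zero.2 (ENNReal.natCast_ne_top _)

lemma levelWeight_ne_zero (N : ℕ+) : levelWeight N ≠ 0 :=
  ENNReal.inv_ne_zero.2 (by simp)

lemma tsum_levelWeight_ne_top : ∑' N : ℕ+, levelWeight N ≠ ∞ := by
  have h : Summable fun N : ℕ+ => ((N : ℝ) ^ 2)⁻¹ :=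
    (Real.summable_nat_pow_inv.2 one_lt_two).comp_injective PNat.coe_injective
  have := h.tsum_ofReal_ne_top
  convert this with N
  have hN : (0 : ℝ) < (N : ℝ) ^ 2 := by positivity
  rw [levelWeight, ENNReal.ofReal_inv_of_pos hN, ENNReal.ofReal_pow (Nat.cast_nonneg _)]
  simp

/-- A sum over `𝔽_N` is dominated by the sum over the corresponding sets of cells. -/
lemma tsum_stepFamily_le (N : ℕ+) (a : Finset (Fin (2 * (N : ℕ) ^ 2)) → ℝ≥0∞) :
    ∑' g : stepFamily N, a (cells g) ≤
      ∑ S ∈ (Finset.univ : Finset (Fin (2 * (N : ℕ) ^ 2))).powersetCard ((N : ℕ) ^ 2), a S := by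
  set T := (Finset.univ : Finset (Fin (2 * (N : ℕ) ^ 2))).powersetCard ((N : ℕ) ^ 2) with hT
  have hmem : ∀ g : stepFamily N, cells g ∈ T := fun g => by
    rw [hT, Finset.mem_powersetCard]
    exact ⟨Finset.subset_univ _, card_cells g⟩
  have hinj : Function.Injective fun g : stepFamily N => (⟨cells g, hmem g⟩ : T) :=
    fun f g h => cells_injective N.pos (congrArg Subtype.val h)
  calc ∑' g : stepFamily N, a (cells g) ≤ ∑' S : T, a S :=
        ENNReal.tsum_comp_le_tsum_of_injective hinj fun S : T => a S
    _ = ∑ S ∈ T, a S := by rw [Finset.tsum_subtype]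

lemma tsum_stepWeight_le_one (N : ℕ+) : ∑' _g : stepFamily N, stepWeight N ≤ 1 := by
  refine (tsum_stepFamily_le N fun _ => stepWeight N).trans ?_
  rw [Finset.sum_const, Finset.card_powersetCard, Finset.card_univ, Fintype.card_fin,
    nsmul_eq_mul, stepWeight]
  exact ENNReal.mul_inv_le_one _

lemma oscMass_ne_top : oscMass ≠ ∞ := by
  refine ne_top_of_le_ne_top tsum_levelWeight_ne_top (ENNReal.tsum_le_tsum fun N => ?_)
  simp_rw [mul_one]
  exact mul_le_of_le_one_right zero_le (tsum_stepWeight_le_one N)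

/-- The density `2` on the upper half belongs to every `𝔽_N`. -/
lemma nonempty_stepFamily (N : ℕ+) : Nonempty (stepFamily N) := by
  classical
  set B := cellUnion N (upperCells N) with hB
  have hBm : MeasurableSet B := measurableSet_cellUnion _ _
  refine ⟨⟨⟨B.indicator fun _ => 2, measurable_const.indicator hBm,
    fun x => Set.indicator_nonneg (fun _ _ => zero_le_two) x, ?_⟩, upperCells N,
    card_upperCells N, fun j hj x hx => ?_, fun j hj x hx => ?_⟩⟩
  · have h : (fun x => ENNReal.ofReal (B.indicator (fun _ => 2) x)) = B.indicator fun _ => 2 := by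
      ext x
      by_cases hx : x ∈ B <;> simp [hx]
    rw [h, lintegral_indicator_const hBm,
      leb_cellUnion_of_card_eq N.pos (card_upperCells N), ENNReal.mul_inv_cancel two_ne_zero
        ENNReal.ofNat_ne_top]
  · change B.indicator (fun _ => (2 : ℝ)) x = 2
    exact Set.indicator_of_mem (mem_cellUnion.2 ⟨j, hj, hx⟩) _
  · change B.indicator (fun _ => (2 : ℝ)) x = 0
    refine Set.indicator_of_notMem (fun hxB => ?_) _
    obtain ⟨i, hi, hxi⟩ := mem_cellUnion.1 hxB
    exact hj (eq_of_mem_cell hx hxi ▸ hi)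

lemma oscMass_ne_zero : oscMass ≠ 0 := by
  obtain ⟨g⟩ := nonempty_stepFamily 1
  refine fun h => (mul_ne_zero (levelWeight_ne_zero 1)
    (mul_ne_zero (stepWeight_ne_zero 1) one_ne_zero)) ?_
  exact nonpos_iff_eq_zero.1 ((le_oscSum (fun _ _ => 1) 1 g).trans_eq h)

lemma sfinite_prior : SFinite prior := by
  have := finite_stepFamily
  unfold prior smoothPrior oscillatingPrior parameterPrior normalizedMeasure
  infer_instance

lemma oscillatingPrior_eq : oscillatingPrior = oscMass⁻¹ • Measure.sum fun N : ℕ+ =>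
    levelWeight N • Measure.sum fun g : stepFamily N =>
      stepWeight N • Measure.dirac (stepMember N g) := by
  rw [oscillatingPrior, normalizedMeasure]
  congr 2
  rw [Measure.sum_apply _ MeasurableSet.univ]
  unfold oscMass oscSum
  congr 1
  ext N
  rw [Measure.smul_apply, Measure.sum_apply _ MeasurableSet.univ]
  simp [levelWeight, stepWeight]

/-- The prior integral as a `θ`-integral plus a sum. Neither the set nor the integrand has to be
measurable. -/
lemma setLIntegral_prior (A : Set model) (h : model → ℝ≥0∞) :
    ∫⁻ f in A, h f ∂prior =
      2⁻¹ * ∫⁻ θ in smoothMember ⁻¹' A, h (smoothMember θ) ∂parameterPrior +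
      2⁻¹ * (oscMass⁻¹ * oscSum fun N g => A.indicator h (stepMember N g)) := by
  classical
  have := finite_stepFamily
  rw [prior, Measure.restrict_add, lintegral_add_measure, Measure.restrict_smul,
    Measure.restrict_smul, lintegral_smul_measure, lintegral_smul_measure, smul_eq_mul,
    smul_eq_mul, smoothPrior, measurableEmbedding_smoothMember.restrict_map,
    measurableEmbedding_smoothMember.lintegral_map, oscillatingPrior_eq, Measure.restrict_smul,
    lintegral_smul_measure, smul_eq_mul, Measure.restrict_sum_of_countable,
    lintegral_sum_measure]
  unfold oscSum
  congr 4
  ext N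
  rw [Measure.restrict_smul, lintegral_smul_measure, smul_eq_mul,
    Measure.restrict_sum_of_countable, lintegral_sum_measure]
  congr 2
  ext g
  rw [Measure.restrict_smul, lintegral_smul_measure, smul_eq_mul, setLIntegral_dirac]
  simp only [Set.indicator_apply]

lemma posterior_apply (fstar : Density leb) (n : ℕ) (x : ℕ → Sample) (A : Set model) :
    Density.posterior model prior fstar n x A =
      (∫⁻ g : model, ENNReal.ofReal (Density.likelihoodRatio fstar g n x) ∂prior)⁻¹ *
        ∫⁻ f in A, ENNReal.ofReal (Density.likelihoodRatio fstar f n x) ∂prior := by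
  have := sfinite_prior
  rw [Density.posterior, Measure.smul_apply, smul_eq_mul, withDensity_apply' _ A]

lemma parameterPrior_univ_le : parameterPrior Set.univ ≤ 1 := by
  rw [parameterPrior, normalizedMeasure, Measure.smul_apply, smul_eq_mul, mul_comm]
  exact ENNReal.mul_inv_le_one _

instance : IsFiniteMeasure parameterPrior :=
  ⟨parameterPrior_univ_le.trans_lt ENNReal.one_lt_top⟩

/-! ### Consistency at the step densities -/

lemma integral_step {N : ℕ+} (g : stepFamily N) :
    Integrable (fun x => (g : Density leb) x) leb ∧ ∫ x, (g : Density leb) x ∂leb = 1 := by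
  have h1 : ∀ᵐ x ∂leb, 0 ≤ (g : Density leb) x := ae_of_all _ (g : Density leb).nonneg
  have h2 := (g : Density leb).measurable_toFun.aestronglyMeasurable (μ := leb)
  have h3 := (g : Density leb).lintegral_eq_one
  refine ⟨(lintegral_ofReal_ne_top_iff_integrable h2 h1).1 (by rw [h3]; simp), ?_⟩
  rw [integral_eq_lintegral_of_nonneg_ae h1 h2, h3]
  simp

/-- For two step densities, the affinity equals the mass that the first one puts on the support of
the second one. -/
lemma law_step_support_le {N M : ℕ+} (g : stepFamily N) (gs : stepFamily M) {ε : ℝ} (hε : 0 < ε)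
    (h : ε < Density.hellingerDist (g : Density leb) gs) :
    ((g : Density leb).law : Measure Sample) {x | (gs : Density leb) x ≠ 0} ≤
      ENNReal.ofReal (1 - ε ^ 2 / 2) := by
  set A := cellUnion N (cells g) with hA
  set B := cellUnion M (cells gs) with hB
  have hAm : MeasurableSet A := measurableSet_cellUnion _ _
  have hBm : MeasurableSet B := measurableSet_cellUnion _ _
  have hsupp : {x | (gs : Density leb) x ≠ 0} = B := by
    ext x
    by_cases hx : x ∈ B
    · simp [hx, step_apply_of_mem gs hx]
    · simp [hx, step_apply_of_notMem M.pos gs hx]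
  have hpt : ∀ x, (Real.sqrt ((g : Density leb) x) - Real.sqrt ((gs : Density leb) x)) ^ 2 =
      (g : Density leb) x + (gs : Density leb) x - (A ∩ B).indicator (fun _ => 4) x := by
    intro x
    by_cases hxA : x ∈ A <;> by_cases hxB : x ∈ B <;>
      simp only [hxA, hxB, step_apply_of_mem, step_apply_of_notMem N.pos g (x := x),
        step_apply_of_notMem M.pos gs (x := x), Set.indicator, Set.mem_inter_iff, hA.symm,
        hB.symm, not_false_eq_true] <;> norm_num
  have hd : Density.hellingerDist (g : Density leb) gs ^ 2 = 2 - 4 * leb.real (A ∩ B) := by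
    have i1 := integral_step g
    have i2 := integral_step gs
    have i12 : Integrable (fun x => (g : Density leb) x + (gs : Density leb) x) leb :=
      i1.1.add i2.1
    rw [Density.hellingerDist, Real.sq_sqrt (integral_nonneg fun x => sq_nonneg _)]
    simp_rw [hpt]
    rw [integral_sub i12 ((integrable_const _).indicator (hAm.inter hBm)),
      integral_add i1.1 i2.1, i1.2, i2.2, integral_indicator_const _ (hAm.inter hBm), smul_eq_mul]
    ring
  have hsq : ε ^ 2 < Density.hellingerDist (g : Density leb) gs ^ 2 := by gcongr
  rw [hsupp, law_step_apply N.pos, ← ofReal_measureReal, ← ENNReal.ofReal_ofNat 2,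
    ← ENNReal.ofReal_mul zero_le_two]
  refine ENNReal.ofReal_le_ofReal ?_
  linarith

lemma ofReal_one_sub_pow_le {a δ : ℝ} (h : 2 * δ ≤ a) (n : ℕ) :
    ENNReal.ofReal (1 - a) ^ n ≤ ENNReal.ofReal (Real.exp (-(2 * δ * n))) := by
  have h1 : 1 - a ≤ Real.exp (-(2 * δ)) :=
    (Real.one_sub_le_exp_neg a).trans (Real.exp_le_exp.2 (by linarith))
  refine (pow_le_pow_left' (ENNReal.ofReal_le_ofReal h1) n).trans ?_
  rw [← ENNReal.ofReal_pow (Real.exp_pos _).le, ← Real.exp_nat_mul]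
  refine le_of_eq ?_
  congr 2
  ring

lemma measurable_likelihoodRatio_uncurry (fstar : Density leb) (n : ℕ) :
    Measurable fun p : (ℕ → Sample) × Set.Icc (0 : ℝ) 1 =>
      ENNReal.ofReal (Density.likelihoodRatio fstar (smoothDensity p.2) n p.1) := by
  refine ENNReal.measurable_ofReal.comp (Finset.measurable_fun_prod _ fun i _ => ?_)
  have h1 : Measurable fun p : (ℕ → Sample) × Set.Icc (0 : ℝ) 1 => normalQuantile (p.1 i) :=
    measurable_normalQuantile_sample.comp ((measurable_pi_apply i).comp measurable_fst)
  have h2 : Measurable fun p : (ℕ → Sample) × Set.Icc (0 : ℝ) 1 => fstar (p.1 i) :=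
    fstar.measurable_toFun.comp ((measurable_pi_apply i).comp measurable_fst)
  simp_rw [smoothDensity_apply]
  fun_prop

theorem hellingerConsistentAt_step (M : ℕ+) (gs : stepFamily M) :
    Density.HellingerConsistentAt model prior gs := by
  intro ε hε
  set A : Set model := {f | ε < Density.hellingerDist (f : Density leb) gs} with hA
  set L : ℕ → (ℕ → Sample) → Density leb → ℝ≥0∞ := fun n x f =>
    ENNReal.ofReal (Density.likelihoodRatio (gs : Density leb) f n x) with hL
  -- `2δ` is the smaller of the two losses of affinity, of the smooth and of the step densities.
  set δ : ℝ := min (Real.exp (-2) / 4) (ε ^ 2 / 2) / 2 with hδ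
  have hδ0 : 0 < δ := by positivity
  have hsupp : {x | (gs : Density leb) x ≠ 0} = cellUnion M (cells gs) := by
    ext x
    by_cases hx : x ∈ cellUnion M (cells gs)
    · simp [hx, step_apply_of_mem gs hx]
    · simp [hx, step_apply_of_notMem M.pos gs hx]
  set E : ℕ → ℝ≥0∞ := fun n => ENNReal.ofReal (Real.exp (-(2 * δ * n))) with hE
  set Y : ℕ → (ℕ → Sample) → ℝ≥0∞ := fun n x =>
    2⁻¹ * ∫⁻ θ, L n x (smoothDensity θ) ∂parameterPrior +
    2⁻¹ * (oscMass⁻¹ * oscSum fun N g =>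
      A.indicator (fun f : model => L n x f) (stepMember N g)) with hY
  have hm1 : ∀ n, Measurable fun x => ∫⁻ θ, L n x (smoothDensity θ) ∂parameterPrior :=
    fun n => (measurable_likelihoodRatio_uncurry _ n).lintegral_prod_right'
  have hm2 : ∀ n (N : ℕ+) (g : stepFamily N), Measurable fun x =>
      A.indicator (fun f : model => L n x f) (stepMember N g) := by
    intro n N g
    by_cases hg : stepMember N g ∈ A
    · simp only [Set.indicator_of_mem hg]
      exact Density.measurable_ofReal_likelihoodRatio _ _ n
    · simp only [Set.indicator_of_notMem hg]
      exact measurable_const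
  have hYm : ∀ n, Measurable (Y n) := fun n =>
    ((hm1 n).const_mul _).add (((measurable_oscSum (hm2 n)).const_mul _).const_mul _)
  have hYint : ∀ n : ℕ, ∫⁻ x, Y n x ∂(gs : Density leb).obs ≤
      1 * ENNReal.ofReal (Real.exp (-(2 * δ * n))) := by
    intro n
    rw [one_mul, hY]
    simp only
    rw [lintegral_add_left ((hm1 n).const_mul _), lintegral_const_mul _ (hm1 n),
      lintegral_const_mul _ ((measurable_oscSum (hm2 n)).const_mul _),
      lintegral_const_mul _ (measurable_oscSum (hm2 n)), lintegral_oscSum (hm2 n),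
      lintegral_lintegral_swap (measurable_likelihoodRatio_uncurry _ n).aemeasurable]
    have h1 : ∫⁻ θ, ∫⁻ x, L n x (smoothDensity θ) ∂(gs : Density leb).obs ∂parameterPrior ≤
        E n := by
      calc _ ≤ ∫⁻ _, E n ∂parameterPrior := by
            refine lintegral_mono fun θ => ?_
            rw [hL]
            simp only
            rw [Density.lintegral_likelihoodRatio, hsupp]
            refine (pow_le_pow_left' (law_smoothDensity_le_of_half θ (measurableSet_cellUnion _ _)
              (leb_cellUnion_of_card_eq M.pos (card_cells gs))) n).trans
              (ofReal_one_sub_pow_le ?_ n)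
            rw [hδ]
            linarith [min_le_left (Real.exp (-2) / 4) (ε ^ 2 / 2)]
        _ ≤ E n := by
            rw [lintegral_const]
            exact mul_le_of_le_one_right zero_le parameterPrior_univ_le
    have h2 : oscMass⁻¹ * oscSum (fun N g => ∫⁻ x, A.indicator (fun f : model => L n x f)
        (stepMember N g) ∂(gs : Density leb).obs) ≤ E n := by
      calc _ ≤ oscMass⁻¹ * oscSum (fun _ _ => E n * 1) := by
            gcongr
            refine oscSum_mono fun N g => ?_
            by_cases hg : stepMember N g ∈ A
            · simp only [Set.indicator_of_mem hg, mul_one]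
              rw [hL]
              simp only
              rw [Density.lintegral_likelihoodRatio]
              refine (pow_le_pow_left' (law_step_support_le g gs hε hg) n).trans
                (ofReal_one_sub_pow_le ?_ n)
              rw [hδ]
              linarith [min_le_right (Real.exp (-2) / 4) (ε ^ 2 / 2)]
            · simp only [Set.indicator_of_notMem hg, lintegral_zero]
              exact zero_le
        _ = E n * (oscMass * oscMass⁻¹) := by
            rw [oscSum_const_mul, ← oscMass]
            ring
        _ ≤ E n := mul_le_of_le_one_right zero_le (ENNReal.mul_inv_le_one _)
    calc _ ≤ 2⁻¹ * E n + 2⁻¹ * E n := by gcongr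
      _ = E n := by rw [← add_mul, ENNReal.inv_two_add_inv_two, one_mul]
  have hc : (2⁻¹ : ℝ≥0∞) * (oscMass⁻¹ * (levelWeight M * stepWeight M)) ≠ 0 :=
    mul_ne_zero (by simp) (mul_ne_zero (ENNReal.inv_ne_zero.2 oscMass_ne_top)
      (mul_ne_zero (levelWeight_ne_zero M) (stepWeight_ne_zero M)))
  have hpos : ∀ᵐ y ∂((gs : Density leb).law : Measure Sample), (gs : Density leb) y ≠ 0 := by
    rw [ae_iff]
    simp only [not_not]
    have : {y | (gs : Density leb) y = 0} = (cellUnion M (cells gs))ᶜ := by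
      rw [← hsupp]; ext y; simp
    rw [this, law_step_apply M.pos, Set.inter_compl_self]
    simp
  filter_upwards [ae_tendsto_exp_mul_zero hYm ENNReal.one_ne_top hδ0 hYint,
    Density.ae_obs_of_ae_law _ hpos] with x hx hxpos
  simp_rw [posterior_apply]
  refine tendsto_inv_mul_zero hc (δ := δ) (Eventually.of_forall fun n => ?_)
    (tendsto_of_tendsto_of_tendsto_of_le_of_le tendsto_const_nhds hx (fun _ => zero_le)
      fun n => ?_)
  · -- The atom at the true density carries a fixed part of the denominator.
    have hone : L n x gs = 1 := by
      rw [hL]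
      simp only
      rw [Density.likelihoodRatio, Finset.prod_eq_one fun i _ => div_self (hxpos i)]
      simp
    have hexp : ENNReal.ofReal (Real.exp (-(δ * n))) ≤ 1 := by
      rw [ENNReal.ofReal_le_one, Real.exp_le_one_iff]
      have : 0 ≤ δ * n := by positivity
      linarith
    rw [← setLIntegral_univ, setLIntegral_prior]
    calc _ ≤ (2⁻¹ : ℝ≥0∞) * (oscMass⁻¹ * (levelWeight M * stepWeight M)) :=
          mul_le_of_le_one_right zero_le hexp
      _ = (2⁻¹ : ℝ≥0∞) * (oscMass⁻¹ * (levelWeight M * (stepWeight M * L n x gs))) := by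
          rw [hone, mul_one]
      _ ≤ _ := by
          refine le_trans ?_ (le_add_of_nonneg_left zero_le)
          gcongr
          refine le_trans (le_of_eq ?_) (le_oscSum _ M gs)
          rw [Set.indicator_univ]
          rfl
  · rw [setLIntegral_prior]
    refine mul_le_mul' le_rfl ?_
    exact add_le_add (mul_le_mul' le_rfl (setLIntegral_le_lintegral _ _)) le_rfl

/-! ### Unbalanced sets of cells -/

/-- The generating function of the number of upper cells of a subset, as a product over cells. -/
lemma sum_exp_card_inter_upperCells (N : ℕ) (l : ℝ) :
    ∑ S : Finset (Fin (2 * N ^ 2)), Real.exp (l * (S ∩ upperCells N).card) =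
      (Real.exp l + 1) ^ N ^ 2 * 2 ^ N ^ 2 := by
  have h1 : ∀ S : Finset (Fin (2 * N ^ 2)), Real.exp (l * (S ∩ upperCells N).card) =
      ∏ j ∈ S, if j ∈ upperCells N then Real.exp l else 1 := by
    intro S
    rw [Finset.prod_ite_mem, Finset.prod_const, ← Real.exp_nat_mul, mul_comm]
  simp_rw [h1]
  rw [← Finset.powerset_univ, ← Finset.prod_add_one]
  have h2 : ∀ j : Fin (2 * N ^ 2), ((if j ∈ upperCells N then Real.exp l else 1) + 1 : ℝ) =
      if j ∈ upperCells N then Real.exp l + 1 else 2 := by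
    intro j
    split_ifs <;> norm_num
  simp_rw [h2]
  rw [Finset.prod_ite, Finset.prod_const, Finset.prod_const, Finset.filter_mem_eq_inter,
    Finset.univ_inter, card_upperCells]
  congr 2
  have h3 := Finset.card_filter_add_card_filter_not
    (s := (Finset.univ : Finset (Fin (2 * N ^ 2)))) (fun j => j ∈ upperCells N)
  rw [Finset.filter_mem_eq_inter, Finset.univ_inter, card_upperCells, Finset.card_univ,
    Fintype.card_fin] at h3
  omega

/-- A set of cells is unbalanced if its upper half is too large by the margin `a`, relative to the
expected number `N² / 2`. -/
def Unbalanced (a : ℝ) {N : ℕ} (S : Finset (Fin (2 * N ^ 2))) : Prop :=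
  (1 / 2 + a) * (N : ℝ) ^ 2 ≤ (S ∩ upperCells N).card

open Classical in
/-- Exponential Markov inequality for the number of upper cells in a uniformly chosen subset. -/
lemma card_unbalanced_le (N : ℕ) {a : ℝ} (ha : 0 ≤ a) :
    ((Finset.univ.filter fun S : Finset (Fin (2 * N ^ 2)) => Unbalanced a S).card : ℝ) ≤
      4 ^ N ^ 2 * Real.exp (-(2 * a ^ 2 * (N : ℝ) ^ 2)) := by
  set B := Finset.univ.filter fun S : Finset (Fin (2 * N ^ 2)) => Unbalanced a S
  -- `4 * a` minimizes the resulting bound on the exponent.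
  have h1 : (B.card : ℝ) * Real.exp (4 * a * ((1 / 2 + a) * (N : ℝ) ^ 2)) ≤
      (Real.exp (4 * a) + 1) ^ N ^ 2 * 2 ^ N ^ 2 := by
    rw [← sum_exp_card_inter_upperCells, ← nsmul_eq_mul]
    refine le_trans (Finset.card_nsmul_le_sum B
      (fun S => Real.exp (4 * a * (S ∩ upperCells N).card)) _ fun S hS => ?_)
      (Finset.sum_le_univ_sum_of_nonneg fun S => (Real.exp_pos _).le)
    have : Unbalanced a S := (Finset.mem_filter.1 hS).2
    exact Real.exp_le_exp.2 (mul_le_mul_of_nonneg_left this (by positivity))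
  have h2 : Real.exp (4 * a) + 1 ≤ 2 * Real.exp (2 * a + 2 * a ^ 2) := by
    have h := Real.cosh_le_exp_half_sq (2 * a)
    rw [Real.cosh_eq] at h
    have e1 : Real.exp (4 * a) = Real.exp (2 * a) * Real.exp (2 * a) := by
      rw [← Real.exp_add]; ring_nf
    have e2 : (1 : ℝ) = Real.exp (2 * a) * Real.exp (-(2 * a)) := by
      rw [← Real.exp_add]; simp
    have e3 : Real.exp (2 * a + 2 * a ^ 2) = Real.exp (2 * a) * Real.exp ((2 * a) ^ 2 / 2) := by
      rw [← Real.exp_add]; ring_nf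
    rw [e1, e3]
    have := mul_le_mul_of_nonneg_left h (Real.exp_pos (2 * a)).le
    linarith
  have h3 : (Real.exp (4 * a) + 1) ^ N ^ 2 * 2 ^ N ^ 2 ≤
      4 ^ N ^ 2 * Real.exp ((2 * a + 2 * a ^ 2) * (N : ℝ) ^ 2) := by
    calc _ ≤ (2 * Real.exp (2 * a + 2 * a ^ 2)) ^ N ^ 2 * 2 ^ N ^ 2 := by gcongr
      _ = _ := by
        rw [← mul_pow, mul_right_comm, mul_pow, ← Real.exp_nat_mul]
        norm_num
        ring
  have h4 := h1.trans h3
  rw [← le_div_iff₀ (Real.exp_pos _), mul_div_assoc, ← Real.exp_sub] at h4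
  refine h4.trans (le_of_eq ?_)
  congr 2
  ring

open Classical in
/-- The oscillating prior gives exponentially small weight to unbalanced densities. -/
lemma tsum_unbalanced_le (N : ℕ+) {a : ℝ} (ha : 0 ≤ a) :
    levelWeight N * ∑' g : stepFamily N, stepWeight N *
      (if Unbalanced a (cells g) then 1 else 0) ≤
      2 * ENNReal.ofReal (Real.exp (-(2 * a ^ 2 * (N : ℝ) ^ 2))) := by
  have hN : (0 : ℝ) < (N : ℝ) ^ 2 := by positivity
  set B := Finset.univ.filter fun S : Finset (Fin (2 * (N : ℕ) ^ 2)) => Unbalanced a S with hB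
  have hK0 : 0 < ((N : ℕ) ^ 2) := by positivity
  have hKN : (((N : ℕ) ^ 2 : ℕ) : ℝ) = (N : ℝ) ^ 2 := by push_cast; rfl
  have h1 : ∑' g : stepFamily N, stepWeight N * (if Unbalanced a (cells g) then 1 else 0) ≤
      stepWeight N * B.card := by
    refine (tsum_stepFamily_le N fun S => stepWeight N * if Unbalanced a S then 1 else 0).trans ?_
    refine (Finset.sum_le_univ_sum_of_nonneg fun _ => zero_le).trans (le_of_eq ?_)
    rw [← Finset.mul_sum, Finset.sum_boole]
  obtain ⟨C, hC'⟩ : ∃ C, C = Nat.choose (2 * (N : ℕ) ^ 2) ((N : ℕ) ^ 2) := ⟨_, rfl⟩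
  have hC : (0 : ℝ) < C := by
    rw [hC']
    exact Nat.cast_pos.2 (Nat.choose_pos (Nat.le_mul_of_pos_left _ two_pos))
  have e1 : levelWeight N = ENNReal.ofReal ((((N : ℕ) ^ 2 : ℕ) : ℝ)⁻¹) := by
    rw [levelWeight, hKN, ENNReal.ofReal_inv_of_pos hN, ENNReal.ofReal_pow (Nat.cast_nonneg _)]
    simp
  have e2 : stepWeight N = ENNReal.ofReal ((C : ℝ)⁻¹) := by
    rw [stepWeight, ← hC', ENNReal.ofReal_inv_of_pos hC, ENNReal.ofReal_natCast]
  refine (mul_le_mul' le_rfl h1).trans ?_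
  rw [e1, e2, ← ENNReal.ofReal_natCast B.card, ← ENNReal.ofReal_mul (by positivity),
    ← ENNReal.ofReal_mul (by positivity), ← ENNReal.ofReal_ofNat 2,
    ← ENNReal.ofReal_mul (by positivity)]
  refine ENNReal.ofReal_le_ofReal ?_
  have h2 := card_unbalanced_le N ha
  have h3 : (4 : ℝ) ^ ((N : ℕ) ^ 2) ≤ 2 * (((N : ℕ) ^ 2 : ℕ) : ℝ) * C := by
    have := Nat.four_pow_le_two_mul_self_mul_centralBinom ((N : ℕ) ^ 2) hK0
    rw [Nat.centralBinom, ← hC'] at this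
    exact_mod_cast this
  rw [inv_mul_le_iff₀ (by positivity), inv_mul_le_iff₀ hC]
  refine h2.trans ?_
  calc _ ≤ (2 * (((N : ℕ) ^ 2 : ℕ) : ℝ) * C) * Real.exp (-(2 * a ^ 2 * (N : ℝ) ^ 2)) := by
        gcongr
    _ = _ := by ring

lemma card_stepFamily_le (N : ℕ+) : ∑' _g : stepFamily N, (1 : ℝ≥0∞) ≤ 4 ^ (N : ℕ) ^ 2 := by
  refine (tsum_stepFamily_le N fun _ => 1).trans ?_
  rw [Finset.sum_const, Finset.card_powersetCard, Finset.card_univ, Fintype.card_fin,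
    nsmul_eq_mul, mul_one]
  have h : Nat.choose (2 * (N : ℕ) ^ 2) ((N : ℕ) ^ 2) ≤ 4 ^ (N : ℕ) ^ 2 := by
    refine (Nat.choose_le_two_pow _ _).trans ?_
    rw [pow_mul]
    norm_num
  exact_mod_cast h

/-! ### The oscillating densities under `f_θ`, `θ > 0` -/

lemma law_step_upperHalf_le {N : ℕ+} (g : stepFamily N) {a : ℝ} (h : ¬ Unbalanced a (cells g)) :
    ((g : Density leb).law : Measure Sample) upperHalf ≤ ENNReal.ofReal (1 / 2 + a) := by
  have hN : (0 : ℝ) < (N : ℝ) ^ 2 := by positivity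
  rw [law_step_apply N.pos, cellUnion_inter_upperHalf, leb_cellUnion]
  have h1 : ((cells g ∩ upperCells N).card : ℝ) ≤ (1 / 2 + a) * (N : ℝ) ^ 2 := (not_le.1 h).le
  have e1 : (2 * ((N : ℕ) : ℝ≥0∞) ^ 2)⁻¹ = ENNReal.ofReal ((2 * (N : ℝ) ^ 2)⁻¹) := by
    rw [ENNReal.ofReal_inv_of_pos (by positivity), ENNReal.ofReal_mul two_pos.le,
      ENNReal.ofReal_pow (Nat.cast_nonneg _)]
    simp
  rw [e1, ← ENNReal.ofReal_natCast (Finset.card _), ← ENNReal.ofReal_mul (by positivity),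
    ← ENNReal.ofReal_ofNat 2, ← ENNReal.ofReal_mul (by positivity)]
  refine ENNReal.ofReal_le_ofReal ?_
  rw [mul_inv]
  calc _ = ((cells g ∩ upperCells N).card : ℝ) * ((N : ℝ) ^ 2)⁻¹ := by
        ring
    _ ≤ ((1 / 2 + a) * (N : ℝ) ^ 2) * ((N : ℝ) ^ 2)⁻¹ := by gcongr
    _ = _ := by field_simp

/-- The weight of one observation in the exponential Markov inequality for the number of
observations in the upper half exceeding the proportion `q`. -/
def chernoffWeight (l q : ℝ) (x : Sample) : ℝ≥0∞ :=
  ENNReal.ofReal (Real.exp (l * (upperHalf.indicator 1 x - q)))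

lemma measurable_chernoffWeight (l q : ℝ) : Measurable (chernoffWeight l q) := by
  unfold chernoffWeight
  have : Measurable (upperHalf.indicator (1 : Sample → ℝ)) :=
    measurable_one.indicator measurableSet_upperHalf
  fun_prop

lemma prod_chernoffWeight (l q : ℝ) (n : ℕ) (x : ℕ → Sample) :
    ∏ i ∈ Finset.range n, chernoffWeight l q (x i) =
      ENNReal.ofReal (Real.exp (l * (∑ i ∈ Finset.range n, upperHalf.indicator 1 (x i) - n * q)))
      := by
  unfold chernoffWeight
  rw [← ENNReal.ofReal_prod_of_nonneg fun _ _ => (Real.exp_pos _).le, ← Real.exp_sum,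
    ← Finset.mul_sum, Finset.sum_sub_distrib]
  simp

/-- The factor contributed by each observation from a balanced step density, in the exponential
Markov inequality for a proportion of at least `1 / 2 + 2a` of the observations in the upper
half. -/
lemma lintegral_chernoffWeight_le {N : ℕ+} (g : stepFamily N) {a : ℝ} (ha : 0 < a)
    (ha' : a ≤ 1 / 6) (h : ¬ Unbalanced a (cells g)) :
    ∫⁻ y, chernoffWeight a (1 / 2 + 2 * a) y ∂((g : Density leb).law : Measure Sample) ≤
      ENNReal.ofReal (Real.exp (-(a ^ 2 / 3))) := by
  set μ : Measure Sample := ((g : Density leb).law : Measure Sample)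
  set w : ℝ := Real.exp (-(a * (1 / 2 + 2 * a))) with hw
  have hw0 : 0 < w := Real.exp_pos _
  have he : 0 ≤ Real.exp a - 1 := by linarith [Real.add_one_le_exp a]
  have h1 : ∀ y, chernoffWeight a (1 / 2 + 2 * a) y =
      ENNReal.ofReal w +
        upperHalf.indicator (fun _ => ENNReal.ofReal (w * (Real.exp a - 1))) y := by
    intro y
    by_cases hy : y ∈ upperHalf
    · rw [Set.indicator_of_mem hy, ← ENNReal.ofReal_add hw0.le (by positivity), chernoffWeight,
        Set.indicator_of_mem hy, Pi.one_apply, mul_sub, mul_one, sub_eq_add_neg, Real.exp_add]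
      congr 1
      ring
    · rw [Set.indicator_of_notMem hy, add_zero, chernoffWeight, Set.indicator_of_notMem hy, hw]
      congr 2
      ring
  simp_rw [h1]
  rw [lintegral_add_left measurable_const, lintegral_const, measure_univ, mul_one,
    lintegral_indicator_const measurableSet_upperHalf]
  calc _ ≤ ENNReal.ofReal w + ENNReal.ofReal (w * (Real.exp a - 1)) *
        ENNReal.ofReal (1 / 2 + a) := by
        gcongr
        exact law_step_upperHalf_le g h
    _ = ENNReal.ofReal (w * (1 + (1 / 2 + a) * (Real.exp a - 1))) := by
        rw [← ENNReal.ofReal_mul (by positivity),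
          ← ENNReal.ofReal_add hw0.le (by positivity)]
        congr 1
        ring
    _ ≤ _ := by
        refine ENNReal.ofReal_le_ofReal ?_
        have h2 : Real.exp a - 1 ≤ a + a ^ 2 := by
          have := abs_le.1 (Real.abs_exp_sub_one_sub_id_le (x := a)
            (by rw [abs_of_pos ha]; linarith))
          linarith [this.2]
        have h3 : 1 + (1 / 2 + a) * (Real.exp a - 1) ≤ Real.exp ((1 / 2 + a) * (a + a ^ 2)) := by
          refine le_trans ?_ (Real.add_one_le_exp _)
          nlinarith
        calc w * (1 + (1 / 2 + a) * (Real.exp a - 1)) ≤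
              w * Real.exp ((1 / 2 + a) * (a + a ^ 2)) := by gcongr
          _ ≤ _ := by
              rw [hw, ← Real.exp_add]
              refine Real.exp_le_exp.2 ?_
              nlinarith [mul_nonneg (sq_nonneg a) (sub_nonneg.2 ha')]

/-- Densities that oscillate slowly compared with the sample size are eventually excluded by the
observations: there are too few of them, and each of them gives up a fixed part of the mass of
`f_θ`. -/
lemma ae_eventually_not_subset_cellUnion (θ : Set.Icc (0 : ℝ) 1) :
    ∃ L : ℕ, 0 < L ∧ ∀ᵐ x ∂(smoothDensity θ).obs, ∀ᶠ n : ℕ in atTop,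
      ∀ (N : ℕ+) (g : stepFamily N), L * (N : ℕ) ^ 2 < n →
        ∃ i ∈ Finset.range n, x i ∉ cellUnion N (cells g) := by
  set b : ℝ := Real.exp (-2) / 4 with hb
  have hb0 : 0 < b := by positivity
  -- `L N² < n` gives `6 N² ≤ b n`: half of the exponent `b n` absorbs both the number
  -- `4 ^ N² ≤ exp (2 N²)` of densities and a factor `exp N` for the summation over `N`.
  obtain ⟨L, hL⟩ := exists_nat_gt (6 / b)
  have hL0 : (0 : ℝ) < L := lt_trans (by positivity) hL
  have hLb : 6 ≤ L * b := ((div_lt_iff₀ hb0).1 hL).le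
  refine ⟨L, by exact_mod_cast hL0, ?_⟩
  set E : ℕ → (N : ℕ+) → stepFamily N → Set (ℕ → Sample) := fun n N g =>
    {x | L * (N : ℕ) ^ 2 < n ∧ ∀ i ∈ Finset.range n, x i ∈ cellUnion N (cells g)} with hE
  have hEle : ∀ n N g, (smoothDensity θ).obs (E n N g) ≤
      (if L * (N : ℕ) ^ 2 < n then ENNReal.ofReal (Real.exp (-(b * n))) else 0) * 1 := by
    intro n N g
    rw [mul_one]
    split_ifs with h
    · have : E n N g = Set.pi (Finset.range n) fun _ => cellUnion N (cells g) := by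
        ext x
        simp [hE, h, Set.mem_pi]
      rw [this, Density.obs, Measure.infinitePi_pi _ fun _ _ => measurableSet_cellUnion _ _,
        Finset.prod_const, Finset.card_range]
      refine (pow_le_pow_left' (law_smoothDensity_le_of_half θ (measurableSet_cellUnion _ _)
        (leb_cellUnion_of_card_eq N.pos (card_cells g))) n).trans ?_
      refine (ofReal_one_sub_pow_le (a := b) (δ := b / 2) (by linarith) n).trans (le_of_eq ?_)
      congr 3
      ring
    · have : E n N g = ∅ := by
        ext x
        simp [hE, h]
      rw [this, measure_empty]
  set C : ℝ≥0∞ := ∑' N : ℕ+, ENNReal.ofReal (Real.exp (-(1 * ((N : ℕ) : ℝ)))) with hC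
  have hCtop : C ≠ ∞ := ne_top_of_le_ne_top (tsum_ofReal_exp_ne_top one_pos)
    (ENNReal.tsum_comp_le_tsum_of_injective PNat.coe_injective
      fun n : ℕ => ENNReal.ofReal (Real.exp (-(1 * (n : ℝ)))))
  have hlevel : ∀ n (N : ℕ+), ∑' g, (smoothDensity θ).obs (E n N g) ≤
      ENNReal.ofReal (Real.exp (-(1 * ((N : ℕ) : ℝ)))) *
        ENNReal.ofReal (Real.exp (-(b / 2 * n))) := by
    intro n N
    refine (ENNReal.tsum_le_tsum (hEle n N)).trans ?_
    rw [ENNReal.tsum_mul_left]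
    refine (mul_le_mul' le_rfl (card_stepFamily_le N)).trans ?_
    split_ifs with h
    · have e4 : (4 : ℝ≥0∞) ^ (N : ℕ) ^ 2 = ENNReal.ofReal (4 ^ (N : ℕ) ^ 2) := by
        rw [ENNReal.ofReal_pow (by norm_num)]
        simp
      rw [e4, ← ENNReal.ofReal_mul (Real.exp_pos _).le, ← ENNReal.ofReal_mul (Real.exp_pos _).le]
      refine ENNReal.ofReal_le_ofReal ?_
      have h4 : (4 : ℝ) ^ (N : ℕ) ^ 2 ≤ Real.exp (2 * (N : ℝ) ^ 2) := by
        have h5 : (4 : ℝ) ≤ Real.exp 2 := by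
          have := Real.exp_one_gt_d9
          have h6 : Real.exp 2 = Real.exp 1 * Real.exp 1 := by rw [← Real.exp_add]; norm_num
          rw [h6]
          nlinarith
        calc (4 : ℝ) ^ (N : ℕ) ^ 2 ≤ Real.exp 2 ^ (N : ℕ) ^ 2 := by gcongr
          _ = _ := by
            rw [← Real.exp_nat_mul]
            congr 1
            push_cast
            ring
      have hn : (L : ℝ) * (N : ℝ) ^ 2 ≤ n := by exact_mod_cast h.le
      have hN1 : (1 : ℝ) ≤ N := by exact_mod_cast N.pos
      calc _ ≤ Real.exp (-(b * n)) * Real.exp (2 * (N : ℝ) ^ 2) := by gcongr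
        _ ≤ _ := by
          rw [← Real.exp_add, ← Real.exp_add]
          refine Real.exp_le_exp.2 ?_
          have h7 : 6 * (N : ℝ) ^ 2 ≤ b * n := by
            calc 6 * (N : ℝ) ^ 2 ≤ L * b * (N : ℝ) ^ 2 := by gcongr
              _ = b * (L * (N : ℝ) ^ 2) := by ring
              _ ≤ b * n := by gcongr
          nlinarith
    · simp
  have hsum : ∑' n, (smoothDensity θ).obs (⋃ N, ⋃ g, E n N g) ≠ ∞ := by
    refine ne_top_of_le_ne_top
      (ENNReal.mul_ne_top hCtop (tsum_ofReal_exp_ne_top (half_pos hb0))) ?_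
    rw [← ENNReal.tsum_mul_left]
    refine ENNReal.tsum_le_tsum fun n => ?_
    rw [hC, ← ENNReal.tsum_mul_right]
    refine (measure_iUnion_le _).trans (ENNReal.tsum_le_tsum fun N => ?_)
    have := finite_stepFamily N
    exact (measure_iUnion_le _).trans (hlevel n N)
  filter_upwards [ae_eventually_notMem hsum] with x hx
  filter_upwards [hx] with n hn N g hLN
  by_contra! hcon
  exact hn (Set.mem_iUnion.2 ⟨N, Set.mem_iUnion.2 ⟨g, hLN, hcon⟩⟩)

/-- The oscillating part of the integrated likelihood is exponentially small under `f_θ`, `θ > 0`.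
Unbalanced densities are either excluded by the data or have small prior weight, balanced ones
predict too few observations in the upper half. -/
lemma ae_tendsto_exp_mul_oscSum {θ : Set.Icc (0 : ℝ) 1} (hθ : θ ≠ 0) :
    ∃ δ : ℝ, 0 < δ ∧ ∀ᵐ x ∂(smoothDensity θ).obs, Tendsto (fun n : ℕ =>
      ENNReal.ofReal (Real.exp (δ * n)) * oscSum fun _ g =>
        ENNReal.ofReal (Density.likelihoodRatio (smoothDensity θ) g n x)) atTop (𝓝 0) := by
  classical
  obtain ⟨L, hL, hLx⟩ := ae_eventually_not_subset_cellUnion θ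
  have hL0 : (0 : ℝ) < L := by exact_mod_cast hL
  set fs := smoothDensity θ with hfs
  set p := (fs.law : Measure Sample).real upperHalf with hp
  have hp1 : p ≤ 1 := measureReal_le_one
  have hp2 : 1 / 2 < p := half_lt_law_upperHalf hθ
  -- The levels `1 / 2 < 1 / 2 + a < 1 / 2 + 2 a < p` separate balanced densities from `f_θ`.
  set a : ℝ := (p - 1 / 2) / 3 with ha
  have ha0 : 0 < a := by rw [ha]; linarith
  have ha6 : a ≤ 1 / 6 := by rw [ha]; linarith
  set δ : ℝ := min (a ^ 2 / 3) (a ^ 2 / L) / 2 with hδ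
  have hδ0 : 0 < δ := by positivity
  have hδ1 : 2 * δ ≤ a ^ 2 / 3 := by
    rw [hδ]; linarith [min_le_left (a ^ 2 / 3) (a ^ 2 / L)]
  have hδ2 : 2 * δ ≤ a ^ 2 / L := by
    rw [hδ]; linarith [min_le_right (a ^ 2 / 3) (a ^ 2 / L)]
  set R : ℕ → (ℕ → Sample) → Density leb → ℝ≥0∞ := fun n x g =>
    ENNReal.ofReal (Density.likelihoodRatio fs g n x) with hR
  have hRm : ∀ n g, Measurable fun x => R n x g := fun n g =>
    Density.measurable_ofReal_likelihoodRatio fs g n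
  set W : ℕ → (ℕ → Sample) → ℝ≥0∞ := fun n x =>
    ∏ i ∈ Finset.range n, chernoffWeight a (1 / 2 + 2 * a) (x i) with hW
  have hWm : ∀ n, Measurable (W n) := fun n =>
    Finset.measurable_fun_prod _ fun i _ =>
      (measurable_chernoffWeight _ _).comp (measurable_pi_apply i)
  -- Eventually this dominates the likelihood ratio: slowly oscillating unbalanced densities are
  -- excluded by the data, and `1 ≤ W n x`.
  set Y : ℕ → (ℕ → Sample) → (N : ℕ+) → stepFamily N → ℝ≥0∞ := fun n x N g =>
    if Unbalanced a (cells g) then (if n ≤ L * (N : ℕ) ^ 2 then R n x g else 0)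
    else W n x * R n x g with hY
  set E : ℕ → ℝ≥0∞ := fun n => ENNReal.ofReal (Real.exp (-(2 * δ * n))) with hE
  have hYm : ∀ n (N : ℕ+) (g : stepFamily N), Measurable fun x => Y n x N g := by
    intro n N g
    simp only [hY]
    split_ifs
    · exact hRm _ _
    · exact measurable_const
    · exact (hWm n).mul (hRm _ _)
  set u : ℕ → (N : ℕ+) → stepFamily N → ℝ≥0∞ := fun n N g =>
    (if n ≤ L * (N : ℕ) ^ 2 then 1 else 0) * (if Unbalanced a (cells g) then 1 else 0) with hu
  have hYint : ∀ n (N : ℕ+) (g : stepFamily N), ∫⁻ x, Y n x N g ∂fs.obs ≤ u n N g + E n * 1 := by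
    intro n N g
    simp only [hY, hu, mul_one]
    by_cases hg : Unbalanced a (cells g)
    · by_cases hn : n ≤ L * (N : ℕ) ^ 2
      · simp only [hg, hn, if_true, mul_one]
        exact (Density.lintegral_likelihoodRatio_le_one fs g n).trans
          (le_add_of_nonneg_right zero_le)
      · simp [hg, hn]
    · simp only [hg, if_false, mul_zero, zero_add]
      refine (Density.lintegral_prod_mul_likelihoodRatio fs g
        (measurable_chernoffWeight _ _) n).trans_le ?_
      refine (pow_le_pow_left' ((setLIntegral_le_lintegral _ _).trans
        (lintegral_chernoffWeight_le g ha0 ha6 hg)) n).trans ?_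
      rw [← ENNReal.ofReal_pow (Real.exp_pos _).le, ← Real.exp_nat_mul]
      refine ENNReal.ofReal_le_ofReal (Real.exp_le_exp.2 ?_)
      have : 2 * δ * n ≤ a ^ 2 / 3 * n := by gcongr
      linarith
  set C : ℝ≥0∞ := 2 * ∑' N : ℕ+, ENNReal.ofReal (Real.exp (-(a ^ 2 * ((N : ℕ) : ℝ)))) with hC
  have hCtop : C ≠ ∞ := ENNReal.mul_ne_top ENNReal.ofNat_ne_top
    (ne_top_of_le_ne_top (tsum_ofReal_exp_ne_top (by positivity : 0 < a ^ 2))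
      (ENNReal.tsum_comp_le_tsum_of_injective PNat.coe_injective
        fun n : ℕ => ENNReal.ofReal (Real.exp (-(a ^ 2 * (n : ℝ))))))
  have husum : ∀ n, oscSum (u n) ≤ C * E n := by
    intro n
    rw [hC, mul_assoc, ← ENNReal.tsum_mul_right, ← ENNReal.tsum_mul_left]
    refine ENNReal.tsum_le_tsum fun N => ?_
    simp only [hu]
    by_cases hn : n ≤ L * (N : ℕ) ^ 2
    · simp only [hn, if_true, one_mul]
      refine (tsum_unbalanced_le N ha0.le).trans ?_
      gcongr
      rw [hE, ← ENNReal.ofReal_mul (Real.exp_pos _).le, ← Real.exp_add]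
      refine ENNReal.ofReal_le_ofReal (Real.exp_le_exp.2 ?_)
      have hn' : (n : ℝ) ≤ L * (N : ℝ) ^ 2 := by exact_mod_cast hn
      have hN1 : (1 : ℝ) ≤ N := by exact_mod_cast N.pos
      have h1 : 2 * δ * n ≤ a ^ 2 * (N : ℝ) ^ 2 := by
        calc 2 * δ * n ≤ a ^ 2 / L * (L * (N : ℝ) ^ 2) := by gcongr
          _ = _ := by field_simp
      have h2 : a ^ 2 * (N : ℝ) ≤ a ^ 2 * (N : ℝ) ^ 2 := by gcongr; nlinarith
      linarith
    · simp [hn]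
  have hYsum : ∀ n : ℕ, ∫⁻ x, oscSum (Y n x) ∂fs.obs ≤
      (C + oscMass) * ENNReal.ofReal (Real.exp (-(2 * δ * n))) := by
    intro n
    rw [lintegral_oscSum (hYm n)]
    refine (oscSum_mono (hYint n)).trans ?_
    rw [oscSum_add, oscSum_const_mul, ← oscMass, add_mul, mul_comm oscMass]
    gcongr
    exact husum n
  have hmeanx := Density.strong_law fs (φ := upperHalf.indicator 1)
    (measurable_one.indicator measurableSet_upperHalf)
    ((integrable_const (1 : ℝ)).indicator measurableSet_upperHalf)
  rw [integral_indicator_one measurableSet_upperHalf] at hmeanx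
  refine ⟨δ, hδ0, ?_⟩
  filter_upwards [ae_tendsto_exp_mul_zero (fun n => measurable_oscSum (hYm n))
    (ENNReal.add_ne_top.2 ⟨hCtop, oscMass_ne_top⟩) hδ0 hYsum, hLx, hmeanx] with x hx hxL hxmean
  refine tendsto_of_tendsto_of_tendsto_of_le_of_le' tendsto_const_nhds hx
    (Eventually.of_forall fun _ => zero_le) ?_
  have hpa : 1 / 2 + 2 * a < p := by rw [ha]; linarith
  filter_upwards [hxL, hxmean.eventually (lt_mem_nhds hpa), eventually_gt_atTop 0]
    with n hn hmean hn0
  refine mul_le_mul' le_rfl (oscSum_mono fun N g => ?_)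
  simp only [hY]
  by_cases hg : Unbalanced a (cells g)
  · by_cases hnN : n ≤ L * (N : ℕ) ^ 2
    · simp only [hg, hnN, if_true]
      exact le_rfl
    · obtain ⟨i, hi, hxi⟩ := hn N g (not_le.1 hnN)
      rw [Density.likelihoodRatio, Finset.prod_eq_zero hi (by
        rw [step_apply_of_notMem N.pos g hxi, zero_div])]
      simp
  · simp only [hg, if_false]
    refine le_mul_of_one_le_left zero_le ?_
    rw [hW]
    simp only
    rw [prod_chernoffWeight, ENNReal.one_le_ofReal, Real.one_le_exp_iff]
    have hn0' : (0 : ℝ) < n := by exact_mod_cast hn0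
    rw [lt_div_iff₀ hn0'] at hmean
    refine mul_nonneg ha0.le ?_
    linarith

/-! ### Consistency at `f_θ`, `θ > 0` -/

/-- The log-likelihood ratio in the Gaussian shift family. -/
lemma likelihoodRatio_smooth (θ θ' : Set.Icc (0 : ℝ) 1) (n : ℕ) (x : ℕ → Sample) :
    Density.likelihoodRatio (smoothDensity θ) (smoothDensity θ') n x =
      Real.exp (n * (-(Real.sqrt (2 * θ') - Real.sqrt (2 * θ)) ^ 2 / 2 +
        (Real.sqrt (2 * θ') - Real.sqrt (2 * θ)) *
          ((∑ i ∈ Finset.range n, normalQuantile (x i)) / n - Real.sqrt (2 * θ)))) := by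
  rw [Density.likelihoodRatio]
  simp_rw [smoothDensity_apply, ← Real.exp_sub]
  rw [← Real.exp_sum]
  congr 1
  have e1 := sq_sqrt_two_mul θ
  have e2 := sq_sqrt_two_mul θ'
  rw [Finset.sum_sub_distrib, Finset.sum_add_distrib, Finset.sum_add_distrib, ← Finset.mul_sum,
    ← Finset.mul_sum]
  simp only [Finset.sum_const, Finset.card_range, nsmul_eq_mul]
  rcases Nat.eq_zero_or_pos n with rfl | hn
  · simp
  · have hn' : (n : ℝ) ≠ 0 := by positivity
    generalize Real.sqrt (2 * θ) = s at *
    generalize Real.sqrt (2 * θ') = t at *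
    generalize ∑ i ∈ Finset.range n, normalQuantile (x i) = z at *
    field_simp
    linear_combination n * (e2 - e1)

lemma strong_law_normalQuantile (θ : Set.Icc (0 : ℝ) 1) :
    ∀ᵐ x ∂(smoothDensity θ).obs, Tendsto (fun n : ℕ =>
      (∑ i ∈ Finset.range n, normalQuantile (x i)) / n) atTop (𝓝 (Real.sqrt (2 * θ))) := by
  have hm := measurable_normalQuantile_sample
  have hi : Integrable (fun y : Sample => normalQuantile y)
      ((smoothDensity θ).law : Measure Sample) := by
    have h := (memLp_id_gaussianReal (μ := Real.sqrt (2 * θ)) (v := 1) 1).integrable (by simp)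
    rw [← map_normalQuantile_law] at h
    exact h.comp_measurable hm
  have h := Density.strong_law (smoothDensity θ) hm hi
  have h1 : ∫ y : Sample, normalQuantile y ∂((smoothDensity θ).law : Measure Sample) =
      Real.sqrt (2 * θ) := by
    have h2 := integral_id_gaussianReal (μ := Real.sqrt (2 * θ)) (v := 1)
    rw [← map_normalQuantile_law, integral_map hm.aemeasurable (by fun_prop)] at h2
    exact h2
  rw [h1] at h
  exact h

/-- The prior of `θ` charges all neighbourhoods of all `θ > 0`. -/
lemma parameterPrior_pos_of_isOpen {V : Set (Set.Icc (0 : ℝ) 1)} (hV : IsOpen V)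
    {θ : Set.Icc (0 : ℝ) 1} (hθ : θ ≠ 0) (hθV : θ ∈ V) : parameterPrior V ≠ 0 := by
  set ν : Measure (Set.Icc (0 : ℝ) 1) := (volume : Measure ℝ).comap Subtype.val with hν
  have hθ0 : (0 : ℝ) < θ := lt_of_le_of_ne θ.2.1 fun h => hθ (Subtype.ext h.symm)
  have hνV : ν V ≠ 0 := by
    obtain ⟨r, hr, hrV⟩ := Metric.isOpen_iff.1 hV θ hθV
    have hsub : Set.Ioc (max 0 (θ - r)) (θ : ℝ) ⊆ Subtype.val '' V := by
      rintro y ⟨hy1, hy2⟩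
      have hy0 : 0 < y := lt_of_le_of_lt (le_max_left _ _) hy1
      have hyr : (θ : ℝ) - r < y := lt_of_le_of_lt (le_max_right _ _) hy1
      refine ⟨⟨y, hy0.le, hy2.trans θ.2.2⟩, hrV ?_, rfl⟩
      rw [Metric.mem_ball, Subtype.dist_eq, Real.dist_eq, abs_lt]
      constructor <;> simp only <;> linarith
    rw [hν, comap_subtype_coe_apply measurableSet_Icc]
    intro h0
    have h1 := measure_mono_null hsub h0
    rw [Real.volume_Ioc, ENNReal.ofReal_eq_zero] at h1
    exact absurd h1 (not_le.2 (sub_pos.2 (max_lt hθ0 (by linarith))))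
  have hνuniv : ν Set.univ = 1 := by
    rw [hν, comap_subtype_coe_apply measurableSet_Icc, Set.image_univ, Subtype.range_coe,
      Real.volume_Icc]
    simp
  set w : Set.Icc (0 : ℝ) 1 → ℝ≥0∞ := fun θ => ENNReal.ofReal (Real.exp (-1 / (θ : ℝ))) with hw
  have hwm : Measurable w := by
    rw [hw]
    fun_prop
  have hV0 : ν.withDensity w V ≠ 0 := fun h0 => hνV
    (withDensity_absolutelyContinuous' hwm.aemeasurable
      (ae_of_all _ fun θ => (ENNReal.ofReal_pos.2 (Real.exp_pos _)).ne') h0)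
  have huniv : ν.withDensity w Set.univ ≠ ∞ := by
    rw [withDensity_apply _ MeasurableSet.univ, setLIntegral_univ]
    refine ne_top_of_le_ne_top (b := 1) (by simp) ?_
    calc ∫⁻ θ, w θ ∂ν ≤ ∫⁻ _, 1 ∂ν := by
          refine lintegral_mono fun θ => ?_
          rw [hw, ENNReal.ofReal_le_one, Real.exp_le_one_iff]
          exact div_nonpos_of_nonpos_of_nonneg (by norm_num) θ.2.1
      _ = 1 := by rw [lintegral_one, hνuniv]
  rw [parameterPrior, normalizedMeasure, Measure.smul_apply, smul_eq_mul]
  exact mul_ne_zero (ENNReal.inv_ne_zero.2 huniv) hV0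

/-- The integrated likelihood decays slower than any exponential under `f_θ`. -/
lemma ae_eventually_le_lintegral_prior {θ : Set.Icc (0 : ℝ) 1} (hθ : θ ≠ 0) {δ : ℝ} (hδ : 0 < δ) :
    ∃ c : ℝ≥0∞, c ≠ 0 ∧ ∀ᵐ x ∂(smoothDensity θ).obs, ∀ᶠ n : ℕ in atTop,
      c * ENNReal.ofReal (Real.exp (-(δ * n))) ≤
        ∫⁻ g : model, ENNReal.ofReal (Density.likelihoodRatio (smoothDensity θ) g n x) ∂prior := by
  -- If `|t' - t| < η` and the mean of the `Z(Xᵢ)` is within `1` of `t`, the log-likelihood ratio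
  -- per observation is at least `-η² / 2 - η ≥ -δ`.
  set η : ℝ := min 1 (δ / 2) with hη
  have hη0 : 0 < η := by positivity
  have hη1 : η ≤ 1 := min_le_left _ _
  have hη2 : η ≤ δ / 2 := min_le_right _ _
  set V : Set (Set.Icc (0 : ℝ) 1) :=
    {θ' | |Real.sqrt (2 * θ') - Real.sqrt (2 * θ)| < η} with hV
  have hVo : IsOpen V := isOpen_lt (by fun_prop) continuous_const
  refine ⟨2⁻¹ * parameterPrior V, mul_ne_zero (by simp)
    (parameterPrior_pos_of_isOpen hVo hθ (by simp [hV, hη0])), ?_⟩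
  filter_upwards [strong_law_normalQuantile θ] with x hx
  filter_upwards [Metric.tendsto_nhds.1 hx 1 one_pos] with n hn
  rw [Real.dist_eq] at hn
  rw [← setLIntegral_univ, setLIntegral_prior]
  refine le_trans ?_ (le_add_of_nonneg_right zero_le)
  rw [mul_assoc]
  gcongr
  rw [Set.preimage_univ, setLIntegral_univ]
  refine le_trans ?_ (setLIntegral_le_lintegral V _)
  rw [mul_comm, ← setLIntegral_const]
  refine setLIntegral_mono' hVo.measurableSet fun θ' hθ' => ENNReal.ofReal_le_ofReal ?_
  change _ ≤ Density.likelihoodRatio (smoothDensity θ) (smoothDensity θ') n x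
  rw [likelihoodRatio_smooth]
  refine Real.exp_le_exp.2 ?_
  rw [mul_comm δ, ← mul_neg]
  gcongr
  have h1 : |Real.sqrt (2 * θ') - Real.sqrt (2 * θ)| < η := hθ'
  set d := Real.sqrt (2 * θ') - Real.sqrt (2 * θ)
  set e := (∑ i ∈ Finset.range n, normalQuantile (x i)) / n - Real.sqrt (2 * θ)
  have h2 : |d * e| ≤ η * 1 := by
    rw [abs_mul]
    gcongr
  have h3 : d ^ 2 ≤ η * 1 := by
    rw [← sq_abs, sq]
    exact mul_le_mul h1.le (h1.le.trans hη1) (abs_nonneg _) hη0.le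
  linarith [neg_abs_le (d * e)]

theorem hellingerConsistentAt_smooth {θ : Set.Icc (0 : ℝ) 1} (hθ : θ ≠ 0) :
    Density.HellingerConsistentAt model prior (smoothDensity θ) := by
  intro ε hε
  obtain ⟨δ₀, hδ₀, hosc⟩ := ae_tendsto_exp_mul_oscSum hθ
  set δ : ℝ := min δ₀ (ε ^ 2 / 2) with hδ
  have hδ0 : 0 < δ := by positivity
  have hδ1 : δ ≤ δ₀ := min_le_left _ _
  have hδ2 : δ ≤ ε ^ 2 / 2 := min_le_right _ _
  obtain ⟨c, hc, hden⟩ := ae_eventually_le_lintegral_prior hθ hδ0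
  filter_upwards [hosc, hden, strong_law_normalQuantile θ] with x hx hxden hxmean
  simp_rw [posterior_apply]
  refine tendsto_inv_mul_zero hc hxden ?_
  have hsmall : Tendsto (fun n : ℕ => ENNReal.ofReal (Real.exp (-(ε ^ 2 / 2 * n)))) atTop (𝓝 0) :=
    ENNReal.tendsto_atTop_zero_of_tsum_ne_top (tsum_ofReal_exp_ne_top (by positivity))
  have hosc' := ENNReal.Tendsto.const_mul (a := 2⁻¹ * oscMass⁻¹) hx
    (Or.inr (ENNReal.mul_ne_top (by simp) (ENNReal.inv_ne_top.2 oscMass_ne_zero)))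
  have hlim := hsmall.add hosc'
  rw [mul_zero, add_zero] at hlim
  refine tendsto_of_tendsto_of_tendsto_of_le_of_le' tendsto_const_nhds hlim
    (Eventually.of_forall fun _ => zero_le) ?_
  filter_upwards [Metric.tendsto_nhds.1 hxmean (ε / 2) (by positivity)] with n hn
  rw [Real.dist_eq] at hn
  rw [setLIntegral_prior, mul_add]
  refine add_le_add ?_ ?_
  · have hsub : smoothMember ⁻¹' {f : model | ε < Density.hellingerDist (f : Density leb)
        (smoothDensity θ)} ⊆ {θ' | 2 * ε ≤ |Real.sqrt (2 * θ') - Real.sqrt (2 * θ)|} := by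
      intro θ' hθ'
      have h1 : ε < Density.hellingerDist (smoothDensity θ') (smoothDensity θ) := hθ'
      have h2 := h1.trans_le (hellingerDist_smoothDensity_le θ' θ)
      rw [Set.mem_ofPred_eq]
      linarith
    have hV : MeasurableSet {θ' : Set.Icc (0 : ℝ) 1 |
        2 * ε ≤ |Real.sqrt (2 * θ') - Real.sqrt (2 * θ)|} :=
      measurableSet_le measurable_const (by fun_prop)
    calc _ ≤ ENNReal.ofReal (Real.exp (δ * n)) *
          (1 * ∫⁻ _ in {θ' : Set.Icc (0 : ℝ) 1 |
            2 * ε ≤ |Real.sqrt (2 * θ') - Real.sqrt (2 * θ)|},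
            ENNReal.ofReal (Real.exp (-(ε ^ 2 * n))) ∂parameterPrior) := by
          refine mul_le_mul' le_rfl (mul_le_mul' (ENNReal.inv_le_one.2 one_le_two) ?_)
          refine (lintegral_mono_set hsub).trans (setLIntegral_mono' hV fun θ' hθ' =>
            ENNReal.ofReal_le_ofReal ?_)
          change Density.likelihoodRatio (smoothDensity θ) (smoothDensity θ') n x ≤ _
          rw [likelihoodRatio_smooth]
          refine Real.exp_le_exp.2 ?_
          rw [mul_comm (ε ^ 2), ← mul_neg]
          gcongr
          have h1 : 2 * ε ≤ |Real.sqrt (2 * θ') - Real.sqrt (2 * θ)| := hθ'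
          set d := Real.sqrt (2 * θ') - Real.sqrt (2 * θ)
          set e := (∑ i ∈ Finset.range n, normalQuantile (x i)) / n - Real.sqrt (2 * θ)
          have h2 : d * e ≤ |d| * (ε / 2) :=
            (le_abs_self _).trans (by rw [abs_mul]; gcongr)
          rw [← sq_abs]
          nlinarith
      _ ≤ ENNReal.ofReal (Real.exp (δ * n)) * ENNReal.ofReal (Real.exp (-(ε ^ 2 * n))) := by
          rw [one_mul, setLIntegral_const]
          gcongr
          exact mul_le_of_le_one_right zero_le
            ((measure_mono (Set.subset_univ _)).trans parameterPrior_univ_le)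
      _ ≤ _ := by
          rw [← ENNReal.ofReal_mul (Real.exp_pos _).le, ← Real.exp_add]
          refine ENNReal.ofReal_le_ofReal (Real.exp_le_exp.2 ?_)
          have : δ * n ≤ ε ^ 2 / 2 * n := by gcongr
          linarith
  · calc _ ≤ ENNReal.ofReal (Real.exp (δ₀ * n)) * (2⁻¹ * (oscMass⁻¹ * oscSum fun _ g =>
          ENNReal.ofReal (Density.likelihoodRatio (smoothDensity θ) g n x))) := by
          gcongr
          exact oscSum_mono fun N g => Set.indicator_le_self _ _ _
      _ = _ := by ring

end Barron

theorem mainTheorem5 :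
    ∀ f ∈ Barron.model \ {Barron.uniformDensity},
      Density.HellingerConsistentAt Barron.model Barron.prior f := by
  rintro f ⟨⟨θ, rfl⟩ | hf, hne⟩
  · exact Barron.hellingerConsistentAt_smooth fun h => hne (by rw [h]; rfl)
  · obtain ⟨N, hN⟩ := Set.mem_iUnion.1 hf
    exact Barron.hellingerConsistentAt_step N ⟨f, hN⟩

end
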